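/- **Setting.** Let $\mathcal S$ (the system under learning, SUL) and $\mathcal R$ (the reference model) be complete finite Mealy machines with finite input alphabets $I=I^{\mathcal S}$ and $I^{\mathcal R}$, which may differ. States $p,q$ of (partial) Mealy machines are *apart*, $p\mathrel{\#}q$, with *separating sequence* $\sigma$, written $\sigma\vdash p\mathrel{\#}q$, if $\lambda(p,\sigma)$ and $\lambda(q,\sigma)$ are both defined and different. From the restriction $\mathcal R|_{I}$ one is given a prefix-closed state cover $P$ (a set of input sequences containing an access sequence of every reachable state) and a separating family $\{W_p\}_{p\in Q^{\mathcal R}}$, together with a fixed choice, for all $p\mathrel{\#}p'$ in $\mathcal R|_I$, of a sequence $\mathsf{sep}(p,p')\in W_p\cap W_{p'}$ with $\mathsf{sep}(p,p')\vdash p\mathrel{\#}p'$. As with families computed by partition refinement, it is assumed that $\mathsf{sep}(p,p')$ depends only on the language equivalence classes of $p,p'$ in $\mathcal R$, and that its length is at most the number $o$ of these classes. **The algorithm $AL^{\#}$.** The learner maintains an observation tree $\mathcal T$ (all sequences observed, with their outputs), whose states are named by their access sequences, and a finite set $B$ of tree states, the *basis*; initially both consist of the root. The *frontier* $F$ is the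 set of successors in $\mathcal T$ of basis states that are not in $B$. A state $r\in F$ is *isolated* if it is apart from all $q\in B$, and *identified with* $q\in B$ if it is apart from all basis states except $q$. $\mathcal T$ is *adequate* if every basis state has a transition for every $i\in I$ and every frontier state is identified. For a tree state $q$ and $p\in Q^{\mathcal R}$, $\mathsf{mdeg}(q,p)$ is the fraction of the pairs $(w,i)$ over $I\cap I^{\mathcal R}$ with $\delta^{\mathcal T}(q,wi)$ defined for which the last outputs on $wi$ from $q$ and from $p$ are equal; $q\simeq p$ means that no $p'\in Q^{\mathcal R}$ has $\mathsf{mdeg}(q,p')>\mathsf{mdeg}(q,p)$. An *output query* $w\in I^*$ adds $w$ with $\lambda^{\mathcal S}(w)$ to $\mathcal T$. The rules are: - *Rebuilding*: for $q,q'\in B$, $i\in I$ with $qi\notin B$, not $q'\mathrel{\#}qi$, and $q,qi,q'\in P$, such that $\sigma=\mathsf{sep}(\delta^{\mathcal R}(qi),\delta^{\mathcal R}(q'))$ exists and $qi\sigma$ or $q'\sigma$ is not yet in $\mathcal T$: query $qi\sigma$ and $q'\sigma$. - *Prioritized promotion*: add an isolated $r\in F$ with $r\in P$ to $B$. *Promotion*: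 add an isolated $r\in F$ to $B$. - *Extension*: for $q\in B$, $i\in I$ with $\delta^{\mathcal T}(q,i)$ undefined, query $qi$. - *Separation*: for $r\in F$ and distinct $q,q'\in B$, neither apart from $r$, query $r\sigma$ for some $\sigma$ with $\sigma\vdash q\mathrel{\#}q'$ in $\mathcal T$. *Approximate prioritized separation*: the same, with $\sigma\in W_{\delta^{\mathcal R}(p,i)}$ for some $p\simeq s$, where $s\in B$, $\delta^{\mathcal T}(s,i)=r$ and $i \in I\cap I^{\mathcal R}$. - *Approximate match refinement*: for $q\in B$ with $q\simeq p$, $q\simeq p'$, $p\mathrel{\#}p'$ in $\mathcal R|_I$, and $\sigma=\mathsf{sep}(p,p')$ with $\delta^{\mathcal T}(q,\sigma)$ undefined: query $q\sigma$. - *Approximate match separation*: for $q,q'\in B$, $\delta^{\mathcal T}(q,i)=r\in F$, $q\simeq p$, $\delta^{\mathcal R}(p,i)=p'$, neither $r\mathrel{\#}q'$ nor $r\mathrel{\#}p'$, and $s\not\simeq p'$ for all $s\in B$: query $qi\sigma$ for some $\sigma\vdash q'\mathrel{\#}p'$. - *Equivalence*: fold $\mathcal T$ back to the hypothesis $\mathcal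 H$ with state set $B$, redirecting each transition into a frontier state to the basis state with which it is identified. Call $\sigma$ in $\mathcal T$ a *conflict* if $\delta^{\mathcal H}(\sigma)\mathrel{\#}\delta^{\mathcal T}(\sigma)$ in $\mathcal T$. If there is a conflict, process one. Otherwise pose an equivalence query; if $\mathcal H$ is accepted (it is equivalent to $\mathcal S$), return $\mathcal H$; otherwise an arbitrary $\rho\in I^*$ with $\lambda^{\mathcal H}(\rho)\ne\lambda^{\mathcal S}(\rho)$ is received and queried, and the shortest prefix of $\rho$ that is a conflict is processed. - *Processing a conflict $\sigma$* (as in $L^{\#}$): stop if $\sigma\in B\cup F$. Otherwise let $\rho'$ be the prefix of $\sigma$ in $F$, split $\sigma=\sigma_1\sigma_2$ with $|\sigma_1|=\lfloor(|\rho'|+|\sigma|)/2\rfloor$, let $q'=\delta^{\mathcal H}(\sigma_1)$, query $q'\sigma_2\eta$ for some $\eta\vdash\delta^{\mathcal H}(\sigma)\mathrel{\#}\delta^{\mathcal T}(\sigma)$, and continue with $\sigma_1$ if now $q'\mathrel{\#}\sigma_1$, and with $q'\sigma_2$ otherwise. First, rebuilding and prioritized promotion are applied until neither is applicable; they are not used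 afterwards. Then extension, (approximate prioritized) separation and promotion are applied, in any order; when $\mathcal T$ is adequate (so that none of these is applicable), the first applicable one of approximate match refinement, approximate match separation and equivalence is applied. **Theorem.** Let $n$ be the number of language equivalence classes in the reachable part of $\mathcal S$, $o$ the number of language equivalence classes of states of $\mathcal R$, and $k=|I|$. Every run of $AL^{\#}$, for all choices of rules and witnesses and all counterexamples of the teacher, is finite, and ends by returning a Mealy machine equivalent to $\mathcal S$. It uses $$\mathcal O\bigl(kn^2+kno+no^2+n\log m\bigr)$$ output queries, where the constant is absolute and $m$ is the length of the longest counterexample received ($n\log m$ is read as $0$ if there is none), and at most $n-1$ equivalence queries that are answered by a counterexample; the only other equivalence query is the final, accepted one. -/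

import Mathlib

noncomputable section

/-! ## Mealy machines -/

/-- A partial Mealy machine with states in `Q`, initial state `init` and input alphabet the finite
set `alphabet` of symbols of `A`. `step q a = some (q', o)` says `δ(q, a) = q'` and `λ(q, a) = o`, so
`δ` and `λ` have the same domain. Machines over different alphabets live over one type `A`
of symbols, so that their alphabets can be intersected. -/
structure PartialMealy (Q A O : Type*) where
  alphabet : Finset A
  init : Q
  step : Q → A → Option (Q × O)
  mem_alphabet : ∀ q a x, step q a = some x → a ∈ alphabet

namespace PartialMealy

/-- The machine is complete: every state has a transition for every symbol of the alphabet. -/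
def IsComplete {Q A O : Type*} (M : PartialMealy Q A O) : Prop :=
  ∀ q, ∀ a ∈ M.alphabet, ∃ x, M.step q a = some x

/-- Reading an input sequence: the state reached and the sequence of outputs produced. -/
def run {Q A O : Type*} (M : PartialMealy Q A O) : Q → List A → Option (Q × List O)
  | q, [] => some (q, [])
  | q, a :: w => (M.step q a).bind fun x => (M.run x.1 w).map fun y => (y.1, x.2 :: y.2)

/-- `δ(q, w)`, `none` where undefined. -/
def target {Q A O : Type*} (M : PartialMealy Q A O) (q : Q) (w : List A) : Option Q :=
  (M.run q w).map Prod.fst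

/-- `λ(q, w)`, `none` where undefined. -/
def output {Q A O : Type*} (M : PartialMealy Q A O) (q : Q) (w : List A) : Option (List O) :=
  (M.run q w).map Prod.snd

/-- `w` is a sequence of symbols of the alphabet of `M`. -/
def IsWord {Q A O : Type*} (M : PartialMealy Q A O) (w : List A) : Prop :=
  ∀ a ∈ w, a ∈ M.alphabet

/-- The states reachable from the initial state. -/
def reachable {Q A O : Type*} (M : PartialMealy Q A O) : Set Q :=
  {q | ∃ w, M.target M.init w = some q}

/-- The number of language equivalence classes that meet the set `X` of states
(two states of a complete machine are language equivalent iff they have the same output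
function on input sequences; sequences outside the alphabet give `none` from every state). -/
def numClasses {Q A O : Type*} (M : PartialMealy Q A O) (X : Set Q) : ℕ :=
  ((fun q => M.output q) '' X).ncard

open Classical in
/-- The restriction `M|_J` of `M` to the inputs in `J`. -/
def restrict {Q A O : Type*} (M : PartialMealy Q A O) (J : Finset A) : PartialMealy Q A O where
  alphabet := M.alphabet.filter (· ∈ J)
  init := M.init
  step q a := if a ∈ J then M.step q a else none
  mem_alphabet := by
    intro q a x h
    by_cases ha : a ∈ J
    · rw [if_pos ha] at h
      exact Finset.mem_filter.2 ⟨M.mem_alphabet q a x h, ha⟩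
    · rw [if_neg ha] at h
      exact absurd h (by simp)

/-- Two machines with the same alphabet are equivalent: they give the same (defined) outputs on
every input sequence. -/
def Equivalent {Q Q' A O : Type*} (M : PartialMealy Q A O) (N : PartialMealy Q' A O) : Prop :=
  M.alphabet = N.alphabet ∧
    ∀ w, M.IsWord w → ∃ u, M.output M.init w = some u ∧ N.output N.init w = some u

end PartialMealy

/-- `σ ⊢ p # q`: both outputs are defined on `σ` (so `σ` is over the common alphabet), and differ. -/
def Separates {Q Q' A O : Type*} (M : PartialMealy Q A O) (p : Q) (N : PartialMealy Q' A O) (q : Q')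
    (σ : List A) : Prop :=
  ∃ u v, M.output p σ = some u ∧ N.output q σ = some v ∧ u ≠ v

/-- `p # q`. -/
def Apart {Q Q' A O : Type*} (M : PartialMealy Q A O) (p : Q) (N : PartialMealy Q' A O) (q : Q') :
    Prop :=
  ∃ σ, Separates M p N q σ

/-! ## What is computed from the reference model -/

/-- A prefix-closed state cover `cover`, a separating family `W` and a choice `sep` of separating
sequences from it, all for the restriction `R|_I` of the reference `R` to the alphabet `I`. -/
structure ReferenceData {Q A O : Type*} (R : PartialMealy Q A O) (I : Finset A) where
  cover : Set (List A)
  W : Q → Set (List A)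
  sep : Q → Q → List A
  cover_isWord : ∀ w ∈ cover, (R.restrict I).IsWord w
  cover_prefix : ∀ w ∈ cover, ∀ v, v <+: w → v ∈ cover
  cover_reaches : ∀ q ∈ (R.restrict I).reachable,
    ∃ w ∈ cover, (R.restrict I).target (R.restrict I).init w = some q
  W_isWord : ∀ q, ∀ w ∈ W q, (R.restrict I).IsWord w
  sep_spec : ∀ p q, Apart (R.restrict I) p (R.restrict I) q →
    sep p q ∈ W p ∧ sep p q ∈ W q ∧ Separates (R.restrict I) p (R.restrict I) q (sep p q)

/-! ## Observation trees -/

open Classical in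
/-- The observation tree of the learner. A node is named by its unique access sequence, the root
is `[]`, and `obs w = some o` says that the nonempty sequence `w` has been observed and that `o` was
the output to its last symbol. -/
def obsTree {A O : Type*} (I : Finset A) (obs : List A → Option O) : PartialMealy (List A) A O where
  alphabet := I
  init := []
  step w a := if a ∈ I then (obs (w ++ [a])).map (fun o => (w ++ [a], o)) else none
  mem_alphabet := by
    intro q a x h
    by_contra ha
    rw [if_neg ha] at h
    exact absurd h (by simp)

open Classical in
/-- Add to the observations the sequence `w` with its output sequence `u`. -/
def record {A O : Type*} (obs : List A → Option O) (w : List A) (u : List O) : List A → Option O :=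
  fun v => if v ≠ [] ∧ v <+: w then u[v.length - 1]? else obs v

/-- The observations after the output query `w` to the system `S` under learning. -/
def outputQuery {Q A O : Type*} (S : PartialMealy Q A O) (obs : List A → Option O) (w : List A) :
    List A → Option O :=
  match S.output S.init w with
  | some u => record obs w u
  | none => obs

/-- The frontier: immediate successors in `T` of basis states that are not basis states. -/
def Frontier {A O : Type*} (T : PartialMealy (List A) A O) (B : Finset (List A)) : Set (List A) :=
  {r | r ∉ B ∧ ∃ q ∈ B, ∃ i, T.target q [i] = some r}

/-- `r` is isolated: apart from all basis states. -/
def Isolated {A O : Type*} (T : PartialMealy (List A) A O) (B : Finset (List A)) (r : List A) :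
    Prop :=
  ∀ q ∈ B, Apart T r T q

/-- `r` is identified with the basis state `q`: apart from all basis states except `q`. -/
def IdentifiedWith {A O : Type*} (T : PartialMealy (List A) A O) (B : Finset (List A))
    (r q : List A) : Prop :=
  q ∈ B ∧ ¬ Apart T r T q ∧ ∀ q' ∈ B, q' ≠ q → Apart T r T q'

/-- The tree is adequate: every basis state has a transition for every input and every frontier
state is identified (hence none is isolated). -/
def Adequate {A O : Type*} (T : PartialMealy (List A) A O) (B : Finset (List A)) : Prop :=
  (∀ q ∈ B, ∀ i ∈ T.alphabet, ∃ x, T.step q i = some x) ∧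
    ∀ r ∈ Frontier T B, ∃ q, IdentifiedWith T B r q

/-- `H` is the hypothesis obtained by folding back `T`: its states are the basis states, its
outputs those of `T`, and transitions into frontier states are redirected to the basis state
with which the frontier state is identified. -/
def IsHypothesis {A O : Type*} (T : PartialMealy (List A) A O) (B : Finset (List A))
    (H : PartialMealy B A O) : Prop :=
  H.alphabet = T.alphabet ∧ (H.init : List A) = T.init ∧
    ∀ q : B, ∀ i ∈ T.alphabet, ∃ (r : List A) (o : O) (q' : B),
      T.step q i = some (r, o) ∧ H.step q i = some (q', o) ∧
        (r = q' ∨ (r ∉ B ∧ IdentifiedWith T B r q'))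

/-! ## Approximate state matching -/

/-- The pairs `(w, i)` over the common alphabet of `T` and `R` with `δ(q, wi)` defined in `T`. -/
def wellDefinedPairs {Q A O : Type*} (T : PartialMealy (List A) A O) (R : PartialMealy Q A O)
    (q : List A) : Set (List A × A) :=
  {x | (∀ a ∈ x.1 ++ [x.2], a ∈ T.alphabet ∧ a ∈ R.alphabet) ∧
    ∃ t, T.target q (x.1 ++ [x.2]) = some t}

/-- `λ(δ(q, w), i)`. -/
def lastOutput {Q A O : Type*} (M : PartialMealy Q A O) (q : Q) (w : List A) (i : A) : Option O :=
  (M.target q w).bind fun q' => (M.step q' i).map Prod.snd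

/-- The matching degree of the tree state `q` and the reference state `p`. -/
def mdeg {Q A O : Type*} (T : PartialMealy (List A) A O) (R : PartialMealy Q A O)
    (q : List A) (p : Q) : ℝ :=
  (({x ∈ wellDefinedPairs T R q | lastOutput T q x.1 x.2 = lastOutput R p x.1 x.2}.ncard : ℕ) : ℝ) /
    ((wellDefinedPairs T R q).ncard : ℝ)

/-- `q` approximately matches `p`: no reference state has a larger matching degree with `q`. -/
def ApproxMatches {Q A O : Type*} (T : PartialMealy (List A) A O) (R : PartialMealy Q A O)
    (q : List A) (p : Q) : Prop :=
  ¬ ∃ p', mdeg T R q p < mdeg T R q p'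

/-! ## Applicability of the rules -/

/-- Rebuilding is applicable to the basis states `q`, `q'` and the input `i`, with separating
sequence `σ`. -/
def RebuildingAt {Q A O : Type*} {R : PartialMealy Q A O} {I : Finset A} (K : ReferenceData R I)
    (T : PartialMealy (List A) A O) (B : Finset (List A)) (q q' : List A) (i : A) (σ : List A) :
    Prop :=
  q ∈ B ∧ q' ∈ B ∧ i ∈ I ∧ q ++ [i] ∉ B ∧ ¬ Apart T q' T (q ++ [i]) ∧
    q ∈ K.cover ∧ q ++ [i] ∈ K.cover ∧ q' ∈ K.cover ∧
    (∃ p p', (R.restrict I).target R.init (q ++ [i]) = some p ∧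
      (R.restrict I).target R.init q' = some p' ∧
      Apart (R.restrict I) p (R.restrict I) p' ∧ σ = K.sep p p') ∧
    (T.target q (i :: σ) = none ∨ T.target q' σ = none)

/-- Prioritized promotion is applicable to the frontier state `r`. -/
def PrioritizedPromotionAt {Q A O : Type*} {R : PartialMealy Q A O} {I : Finset A}
    (K : ReferenceData R I) (T : PartialMealy (List A) A O) (B : Finset (List A)) (r : List A) :
    Prop :=
  r ∈ Frontier T B ∧ r ∈ K.cover ∧ Isolated T B r

/-- Promotion is applicable to the frontier state `r`. -/
def PromotionAt {A O : Type*} (T : PartialMealy (List A) A O) (B : Finset (List A)) (r : List A) :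
    Prop :=
  r ∈ Frontier T B ∧ Isolated T B r

/-- Extension is applicable to the basis state `q` and the input `i`. -/
def ExtensionAt {A O : Type*} (T : PartialMealy (List A) A O) (B : Finset (List A))
    (q : List A) (i : A) : Prop :=
  q ∈ B ∧ i ∈ T.alphabet ∧ T.step q i = none

/-- Separation is applicable to the frontier state `r` and the basis states `q ≠ q'`, with
witness `σ` of `q # q'`. -/
def SeparationAt {A O : Type*} (T : PartialMealy (List A) A O) (B : Finset (List A))
    (r q q' : List A) (σ : List A) : Prop :=
  r ∈ Frontier T B ∧ q ∈ B ∧ q' ∈ B ∧ q ≠ q' ∧ ¬ Apart T r T q ∧ ¬ Apart T r T q' ∧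
    Separates T q T q' σ

/-- Approximate prioritized separation is applicable to the frontier state `r` and the basis
states `q'`, `q''`, with separating sequence `σ`. -/
def ApproxPrioritizedSeparationAt {Q A O : Type*} {R : PartialMealy Q A O} {I : Finset A}
    (K : ReferenceData R I) (T : PartialMealy (List A) A O) (B : Finset (List A))
    (r q' q'' : List A) (σ : List A) : Prop :=
  r ∈ Frontier T B ∧ q' ∈ B ∧ q'' ∈ B ∧ ¬ Apart T r T q' ∧ ¬ Apart T r T q'' ∧
    Separates T q' T q'' σ ∧
    ∃ q ∈ B, ∃ i p p', T.target q [i] = some r ∧ ApproxMatches T R q p ∧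
      R.target p [i] = some p' ∧ σ ∈ K.W p'

/-- Approximate match refinement is applicable to the basis state `q` and the reference states
`p`, `p'`. -/
def ApproxMatchRefinementAt {Q A O : Type*} {R : PartialMealy Q A O} {I : Finset A}
    (K : ReferenceData R I) (T : PartialMealy (List A) A O) (B : Finset (List A))
    (q : List A) (p p' : Q) : Prop :=
  q ∈ B ∧ ApproxMatches T R q p ∧ ApproxMatches T R q p' ∧
    Apart (R.restrict I) p (R.restrict I) p' ∧ T.target q (K.sep p p') = none

/-- Approximate match separation is applicable to the basis states `q`, `q'`, the reference state
`p` and the input `i`, with separating sequence `σ`. -/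
def ApproxMatchSeparationAt {Q A O : Type*} (R : PartialMealy Q A O)
    (T : PartialMealy (List A) A O) (B : Finset (List A))
    (q q' : List A) (p : Q) (i : A) (σ : List A) : Prop :=
  q ∈ B ∧ q' ∈ B ∧ ∃ r p', T.target q [i] = some r ∧ r ∈ Frontier T B ∧ ¬ Apart T r T q' ∧
    R.target p [i] = some p' ∧ ¬ Apart T r R p' ∧ ApproxMatches T R q p ∧
    (¬ ∃ s ∈ B, ApproxMatches T R s p') ∧ Separates T q' R p' σ

/-! ## Counterexample processing -/

/-- `σ` is a sequence of the tree `T` that leads the hypothesis and the tree to apart states. -/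
def Conflict {A O : Type*} (T : PartialMealy (List A) A O) {B : Finset (List A)}
    (H : PartialMealy B A O) (σ : List A) : Prop :=
  ∃ (q : B) (r : List A), H.target H.init σ = some q ∧ T.target T.init σ = some r ∧ Apart T q T r

/-- The binary search that processes the conflict `σ`. `ProcCounterEx S H obs σ obs' c` says that,
started on `σ` with observations `obs`, it can end with observations `obs'` after `c` output
queries. While `σ` leads beyond the frontier, it is split in the middle of the part after its
unique prefix `ρ` in the frontier, as `σ = σ₁ σ₂` with `H` reaching `q'` on `σ₁` and `q` on `σ`, and
`q' σ₂ η` is queried for some witness `η` of the conflict. -/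
inductive ProcCounterEx {Q A O : Type*} (S : PartialMealy Q A O) {B : Finset (List A)}
    (H : PartialMealy B A O) :
    (List A → Option O) → List A → (List A → Option O) → ℕ → Prop
  | finish (obs : List A → Option O) (σ : List A) :
      σ ∈ B ∨ σ ∈ Frontier (obsTree S.alphabet obs) B → ProcCounterEx S H obs σ obs 0
  | left (obs obs' obs'' : List A → Option O) (σ ρ η : List A) (q q' : B) (h c : ℕ) :
      ¬ (σ ∈ B ∨ σ ∈ Frontier (obsTree S.alphabet obs) B) →
      ρ <+: σ → ρ ∈ Frontier (obsTree S.alphabet obs) B →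
      h = (ρ.length + σ.length) / 2 →
      H.target H.init σ = some q → H.target H.init (σ.take h) = some q' →
      Separates (obsTree S.alphabet obs) (q : List A) (obsTree S.alphabet obs) σ η →
      obs' = outputQuery S obs (q' ++ σ.drop h ++ η) →
      Apart (obsTree S.alphabet obs') (q' : List A) (obsTree S.alphabet obs') (σ.take h) →
      ProcCounterEx S H obs' (σ.take h) obs'' c →
      ProcCounterEx S H obs σ obs'' (c + 1)
  | right (obs obs' obs'' : List A → Option O) (σ ρ η : List A) (q q' : B) (h c : ℕ) :
      ¬ (σ ∈ B ∨ σ ∈ Frontier (obsTree S.alphabet obs) B) →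
      ρ <+: σ → ρ ∈ Frontier (obsTree S.alphabet obs) B →
      h = (ρ.length + σ.length) / 2 →
      H.target H.init σ = some q → H.target H.init (σ.take h) = some q' →
      Separates (obsTree S.alphabet obs) (q : List A) (obsTree S.alphabet obs) σ η →
      obs' = outputQuery S obs (q' ++ σ.drop h ++ η) →
      ¬ Apart (obsTree S.alphabet obs') (q' : List A) (obsTree S.alphabet obs') (σ.take h) →
      ProcCounterEx S H obs' (q' ++ σ.drop h) obs'' c →
      ProcCounterEx S H obs σ obs'' (c + 1)

/-! ## The algorithm -/

/-- What the learner is doing: the initial rebuilding phase, the main phase, or it has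
terminated and returned the hypothesis `H`. -/
inductive Status (A O : Type*) where
  | rebuilding
  | learning
  | returned (B : Finset (List A)) (H : PartialMealy B A O)

/-- A configuration of the learner: observations, basis and status, together with the number of
output queries and of equivalence queries posed so far (the accepted one included) and the list
of the counterexamples received so far. -/
structure Config (A O : Type*) where
  obs : List A → Option O
  basis : Finset (List A)
  status : Status A O
  oqs : ℕ
  eqs : ℕ
  cexs : List (List A)

/-- The observation tree of a configuration. -/
def Config.tree {A O : Type*} (c : Config A O) (I : Finset A) : PartialMealy (List A) A O :=
  obsTree I c.obs

/-- The length of the longest counterexample received so far (`0` if there is none). -/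
def Config.maxCex {A O : Type*} (c : Config A O) : ℕ :=
  (c.cexs.map List.length).foldr max 0

/-- The initial configuration: the tree and the basis consist of the root only. -/
def Config.initial (A O : Type*) : Config A O where
  obs := fun _ => none
  basis := {[]}
  status := .rebuilding
  oqs := 0
  eqs := 0
  cexs := []

open Classical in
/-- One step of `AL#` for the system `S` and the reference `R`. First rebuilding and
prioritized promotion are applied until neither is applicable. Afterwards extension,
(approximate prioritized) separation and promotion are applied; when the tree is
adequate, which means that none of these is applicable, the learner tries
approximate match refinement, approximate match separation and equivalence, in this order.
The order in which the rules of the first group are tried is left open, so that the steps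
contain those of every schedule; witnesses, and the counterexamples of the teacher, are arbitrary. -/
inductive ALSharpStep {Q Q' A O : Type*} (S : PartialMealy Q A O) (R : PartialMealy Q' A O)
    (K : ReferenceData R S.alphabet) : Config A O → Config A O → Prop
  | rebuilding (c : Config A O) (q q' : List A) (i : A) (σ : List A) :
      c.status = .rebuilding → RebuildingAt K (c.tree S.alphabet) c.basis q q' i σ →
      ALSharpStep S R K c
        { c with
          obs := outputQuery S (outputQuery S c.obs (q ++ i :: σ)) (q' ++ σ)
          oqs := c.oqs + 2 }
  | prioritizedPromotion (c : Config A O) (r : List A) :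
      c.status = .rebuilding → PrioritizedPromotionAt K (c.tree S.alphabet) c.basis r →
      ALSharpStep S R K c { c with basis := insert r c.basis }
  | endRebuilding (c : Config A O) :
      c.status = .rebuilding →
      (¬ ∃ q q' i σ, RebuildingAt K (c.tree S.alphabet) c.basis q q' i σ) →
      (¬ ∃ r, PrioritizedPromotionAt K (c.tree S.alphabet) c.basis r) →
      ALSharpStep S R K c { c with status := .learning }
  | extension (c : Config A O) (q : List A) (i : A) :
      c.status = .learning → ExtensionAt (c.tree S.alphabet) c.basis q i →
      ALSharpStep S R K c
        { c with obs := outputQuery S c.obs (q ++ [i]), oqs := c.oqs + 1 }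
  | approxPrioritizedSeparation (c : Config A O) (r q' q'' σ : List A) :
      c.status = .learning →
      ApproxPrioritizedSeparationAt K (c.tree S.alphabet) c.basis r q' q'' σ →
      ALSharpStep S R K c { c with obs := outputQuery S c.obs (r ++ σ), oqs := c.oqs + 1 }
  | separation (c : Config A O) (r q q' σ : List A) :
      c.status = .learning → SeparationAt (c.tree S.alphabet) c.basis r q q' σ →
      ALSharpStep S R K c { c with obs := outputQuery S c.obs (r ++ σ), oqs := c.oqs + 1 }
  | promotion (c : Config A O) (r : List A) :
      c.status = .learning → PromotionAt (c.tree S.alphabet) c.basis r →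
      ALSharpStep S R K c { c with basis := insert r c.basis }
  | approxMatchRefinement (c : Config A O) (q : List A) (p p' : Q') :
      c.status = .learning → Adequate (c.tree S.alphabet) c.basis →
      ApproxMatchRefinementAt K (c.tree S.alphabet) c.basis q p p' →
      ALSharpStep S R K c
        { c with obs := outputQuery S c.obs (q ++ K.sep p p'), oqs := c.oqs + 1 }
  | approxMatchSeparation (c : Config A O) (q q' : List A) (p : Q') (i : A) (σ : List A) :
      c.status = .learning → Adequate (c.tree S.alphabet) c.basis →
      (¬ ∃ q p p', ApproxMatchRefinementAt K (c.tree S.alphabet) c.basis q p p') →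
      ApproxMatchSeparationAt R (c.tree S.alphabet) c.basis q q' p i σ →
      ALSharpStep S R K c
        { c with obs := outputQuery S c.obs (q ++ i :: σ), oqs := c.oqs + 1 }
  /-- Equivalence rule, hypothesis inconsistent with the tree: a conflict in the tree is processed. -/
  | inconsistent (c : Config A O) (H : PartialMealy c.basis A O) (σ : List A)
      (obs' : List A → Option O) (cost : ℕ) :
      c.status = .learning → Adequate (c.tree S.alphabet) c.basis →
      (¬ ∃ q p p', ApproxMatchRefinementAt K (c.tree S.alphabet) c.basis q p p') →
      (¬ ∃ q q' p i σ, ApproxMatchSeparationAt R (c.tree S.alphabet) c.basis q q' p i σ) →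
      IsHypothesis (c.tree S.alphabet) c.basis H →
      Conflict (c.tree S.alphabet) H σ →
      ProcCounterEx S H c.obs σ obs' cost →
      ALSharpStep S R K c { c with obs := obs', oqs := c.oqs + cost }
  /-- Equivalence rule, equivalence query answered by a counterexample `ρ`: the output query `ρ` is
  posed, and the shortest prefix of `ρ` that is a conflict is processed. -/
  | counterexample (c : Config A O) (H : PartialMealy c.basis A O) (ρ σ : List A)
      (obs' : List A → Option O) (cost : ℕ) :
      c.status = .learning → Adequate (c.tree S.alphabet) c.basis →
      (¬ ∃ q p p', ApproxMatchRefinementAt K (c.tree S.alphabet) c.basis q p p') →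
      (¬ ∃ q q' p i σ, ApproxMatchSeparationAt R (c.tree S.alphabet) c.basis q q' p i σ) →
      IsHypothesis (c.tree S.alphabet) c.basis H →
      (¬ ∃ τ, Conflict (c.tree S.alphabet) H τ) →
      S.IsWord ρ → H.output H.init ρ ≠ S.output S.init ρ →
      σ <+: ρ → Conflict (obsTree S.alphabet (outputQuery S c.obs ρ)) H σ →
      (∀ τ, τ <+: ρ → Conflict (obsTree S.alphabet (outputQuery S c.obs ρ)) H τ →
        σ.length ≤ τ.length) →
      ProcCounterEx S H (outputQuery S c.obs ρ) σ obs' cost →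
      ALSharpStep S R K c
        { c with
          obs := obs'
          oqs := c.oqs + 1 + cost
          eqs := c.eqs + 1
          cexs := ρ :: c.cexs }
  /-- Equivalence rule, equivalence query accepted: the hypothesis is returned. -/
  | accept (c : Config A O) (H : PartialMealy c.basis A O) :
      c.status = .learning → Adequate (c.tree S.alphabet) c.basis →
      (¬ ∃ q p p', ApproxMatchRefinementAt K (c.tree S.alphabet) c.basis q p p') →
      (¬ ∃ q q' p i σ, ApproxMatchSeparationAt R (c.tree S.alphabet) c.basis q q' p i σ) →
      IsHypothesis (c.tree S.alphabet) c.basis H →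
      (¬ ∃ τ, Conflict (c.tree S.alphabet) H τ) →
      (∀ ρ, S.IsWord ρ → H.output H.init ρ = S.output S.init ρ) →
      ALSharpStep S R K c
        { c with status := .returned c.basis H, eqs := c.eqs + 1 }

/-- `c` can occur in a run of `AL#`. -/
def ALSharpReaches {Q Q' A O : Type*} (S : PartialMealy Q A O) (R : PartialMealy Q' A O)
    (K : ReferenceData R S.alphabet) (c : Config A O) : Prop :=
  Relation.ReflTransGen (ALSharpStep S R K) (Config.initial A O) c

end

/-! Every query outside the equivalence rule establishes a fact, a `Milestone`, that did not hold
before and that persists (`Achieved.mono`): a basis state gets a successor, such a successor becomes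
apart from a basis state or from a class of reference states, or the words of a rebuilding or
refinement enter the tree. Basis states are pairwise apart, so there are at most `n` of them
(`card_le_numClasses`). As milestones are indexed by basis states, inputs and classes of reference
states, their number is at most `M = nk + 2n²k + no² + nko` (`achieved_bound`). Rebuilding poses two
queries per milestone and the other rules one, which gives at most `2M` queries.

Processing a conflict is a binary search between the frontier and the end of the conflict
(`ConflictAt.split`), so its cost is at most the binary size of the length of the conflict. It ends
with a conflict in the frontier. There the frontier state becomes apart even from the one basis
state it was identified with, hence isolated (`ProcCounterEx.exists_promotionAt`). The tree is then
not adequate until the basis has grown, so at most `n - 1` conflicts are processed, those coming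
from counterexamples included.

A conflict found in the tree may be longer than the longest counterexample, of length `m`. But each
query other than that of a counterexample deepens the tree by at most `n + o + 1`, so after `N`
queries all observed sequences have length at most `m + (n + o + 1)N`. This gives a bound on `N`
that contains `log N` on the right. Since the logarithm grows slowly, that term is absorbed on the
left at the price of terms in `n²` and `no` (`queries_le_of_self_bound`).

Runs are finite because the basis size plus the number of milestones plus the phase is bounded and
increases in every step (`RunInvariant.step`). They stop only by returning, because otherwise some
rule applies (`RunInvariant.exists_step`), and a returned hypothesis has passed the equivalence
test. -/

/-! ## Runs of Mealy machines -/

namespace PartialMealy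

variable {Q A O : Type*} {M : PartialMealy Q A O}

theorem run_append (M : PartialMealy Q A O) (q : Q) (v w : List A) :
    M.run q (v ++ w) =
      (M.run q v).bind fun x => (M.run x.1 w).map fun y => (y.1, x.2 ++ y.2) := by
  induction v generalizing q with
  | nil => simp [run]
  | cons a v ih =>
    simp only [List.cons_append, run]
    rcases M.step q a with _ | x
    · rfl
    · simp only [Option.bind_some, ih]
      rcases M.run x.1 v with _ | y
      · rfl
      · simp only [Option.bind_some, Option.map_some, Option.map_map]
        rfl

theorem target_append (M : PartialMealy Q A O) (q : Q) (v w : List A) :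
    M.target q (v ++ w) = (M.target q v).bind fun x => M.target x w := by
  simp only [target, run_append]
  rcases M.run q v with _ | y
  · rfl
  · simp only [Option.bind_some, Option.map_some, Option.map_map]
    rfl

theorem target_nil (M : PartialMealy Q A O) (q : Q) : M.target q [] = some q := rfl

theorem target_singleton (M : PartialMealy Q A O) (q : Q) (a : A) :
    M.target q [a] = (M.step q a).map Prod.fst := by
  simp only [target, run]
  rcases M.step q a with _ | x <;> rfl

theorem output_nil (M : PartialMealy Q A O) (q : Q) : M.output q [] = some [] := rfl

theorem output_append (M : PartialMealy Q A O) (q : Q) (v w : List A) :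
    M.output q (v ++ w) = (M.output q v).bind fun u =>
      (M.target q v).bind fun x => (M.output x w).map (u ++ ·) := by
  simp only [target, output, run_append]
  rcases M.run q v with _ | y
  · rfl
  · simp only [Option.bind_some, Option.map_some, Option.map_map]
    rfl

theorem output_singleton (M : PartialMealy Q A O) (q : Q) (a : A) :
    M.output q [a] = (M.step q a).map fun x => [x.2] := by
  simp only [output, run]
  rcases M.step q a with _ | x <;> rfl

theorem output_cons (M : PartialMealy Q A O) (q : Q) (a : A) (w : List A) :
    M.output q (a :: w) = (M.step q a).bind fun x => (M.output x.1 w).map (x.2 :: ·) := by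
  simp only [output, run]
  rcases M.step q a with _ | x
  · rfl
  · simp only [Option.bind_some, Option.map_map]
    rfl

theorem length_of_output {q : Q} {w : List A} {u : List O} (h : M.output q w = some u) :
    u.length = w.length := by
  induction w generalizing q u with
  | nil => simp_all [output_nil]
  | cons a w ih =>
    rw [output_cons, Option.bind_eq_some_iff] at h
    obtain ⟨x, -, h⟩ := h
    rw [Option.map_eq_some_iff] at h
    obtain ⟨u', hu, rfl⟩ := h
    simp [ih hu]

theorem target_isSome_iff {q : Q} {w : List A} :
    (∃ p, M.target q w = some p) ↔ ∃ u, M.output q w = some u := by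
  simp only [target, output]
  rcases M.run q w with _ | y <;> simp

theorem IsWord.append {v w : List A} (hv : M.IsWord v) (hw : M.IsWord w) : M.IsWord (v ++ w) := by
  intro a ha
  rcases List.mem_append.1 ha with h | h
  exacts [hv a h, hw a h]

theorem IsWord.of_prefix {v w : List A} (hw : M.IsWord w) (h : v <+: w) : M.IsWord v :=
  fun a ha => hw a (h.subset ha)

theorem IsWord.of_append_right {v w : List A} (h : M.IsWord (v ++ w)) : M.IsWord w :=
  fun a ha => h a (List.mem_append_right v ha)

theorem IsWord.singleton {a : A} (h : a ∈ M.alphabet) : M.IsWord [a] := by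
  intro b hb
  rwa [List.mem_singleton.1 hb]

theorem isWord_of_output {q : Q} {w : List A} {u : List O} (h : M.output q w = some u) :
    M.IsWord w := by
  induction w generalizing q u with
  | nil => intro a ha; simp at ha
  | cons a w ih =>
    rw [output_cons, Option.bind_eq_some_iff] at h
    obtain ⟨x, hx, h⟩ := h
    rw [Option.map_eq_some_iff] at h
    obtain ⟨u', hu, rfl⟩ := h
    intro b hb
    rcases List.mem_cons.1 hb with rfl | hb
    exacts [M.mem_alphabet _ _ _ hx, ih hu b hb]

theorem IsComplete.exists_output (hM : M.IsComplete) (q : Q) {w : List A} (hw : M.IsWord w) :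
    ∃ u, M.output q w = some u := by
  induction w generalizing q with
  | nil => exact ⟨[], rfl⟩
  | cons a w ih =>
    obtain ⟨x, hx⟩ := hM q a (hw a (by simp))
    obtain ⟨u, hu⟩ := ih x.1 (fun b hb => hw b (by simp [hb]))
    exact ⟨x.2 :: u, by rw [output_cons, hx, Option.bind_some, hu]; rfl⟩

theorem IsComplete.exists_target (hM : M.IsComplete) (q : Q) {w : List A} (hw : M.IsWord w) :
    ∃ p, M.target q w = some p :=
  target_isSome_iff.2 (hM.exists_output q hw)

/-- The output sequence on `σ` after reading `w` from the initial state. -/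
def outputAfter (M : PartialMealy Q A O) (w σ : List A) : Option (List O) :=
  (M.target M.init w).bind fun q => M.output q σ

theorem IsComplete.exists_outputAfter (hM : M.IsComplete) {w σ : List A}
    (h : M.IsWord (w ++ σ)) : ∃ u, M.outputAfter w σ = some u := by
  obtain ⟨q, hq⟩ := hM.exists_target M.init (h.of_prefix (List.prefix_append w σ))
  obtain ⟨u, hu⟩ := hM.exists_output q h.of_append_right
  exact ⟨u, by rw [outputAfter, hq]; exact hu⟩

theorem outputAfter_append {w σ τ : List A} :
    M.outputAfter w (σ ++ τ) =
      (M.outputAfter w σ).bind fun u => (M.outputAfter (w ++ σ) τ).map (u ++ ·) := by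
  simp only [outputAfter, target_append]
  rcases M.target M.init w with _ | q
  · rfl
  · simp only [Option.bind_some, output_append]
    rcases h : M.output q σ with _ | u
    · rfl
    · obtain ⟨p, hp⟩ := target_isSome_iff.2 ⟨u, h⟩
      simp [hp]

theorem isWord_of_restrict_output {q : Q} {J : Finset A} {w : List A} {u : List O}
    (h : (M.restrict J).output q w = some u) : ∀ a ∈ w, a ∈ J := by
  intro a ha
  have hw := isWord_of_output h a ha
  simp only [restrict, Finset.mem_filter] at hw
  exact hw.2

end PartialMealy

theorem Apart.symm {Q Q' A O : Type*} {M : PartialMealy Q A O} {p : Q} {N : PartialMealy Q' A O}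
    {q : Q'} (h : Apart M p N q) : Apart N q M p := by
  obtain ⟨σ, u, v, hu, hv, huv⟩ := h
  exact ⟨σ, v, u, hv, hu, huv.symm⟩

theorem not_apart_self {Q A O : Type*} {M : PartialMealy Q A O} {p : Q} : ¬ Apart M p M p := by
  rintro ⟨σ, u, v, hu, hv, huv⟩
  exact huv (Option.some.inj (hu.symm.trans hv))

/-! ## Observations of a system -/

/-- The sequence `w` is a node of the observation tree. -/
def Seen {A O : Type*} (obs : List A → Option O) (w : List A) : Prop :=
  w = [] ∨ obs w ≠ none

/-- The observations form a tree and are outputs of the system `S`. -/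
structure Consistent {Q A O : Type*} (S : PartialMealy Q A O) (obs : List A → Option O) :
    Prop where
  seen_init : ∀ w a, obs (w ++ [a]) ≠ none → Seen obs w
  sound : ∀ w o, obs w = some o → ∃ v a s s', w = v ++ [a] ∧ S.target S.init v = some s ∧
    S.step s a = some (s', o)

section Observations

variable {Q A O : Type*} {S : PartialMealy Q A O} {obs obs' : List A → Option O}

theorem seen_nil : Seen obs [] := Or.inl rfl

namespace Consistent

theorem seen_of_append (h : Consistent S obs) {v w : List A} (hw : Seen obs (v ++ w)) :
    Seen obs v := by
  induction w using List.reverseRecOn with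
  | nil => simpa using hw
  | append_singleton w a ih =>
    rw [← List.append_assoc] at hw
    rcases hw with hw | hw
    · simp at hw
    · exact ih (h.seen_init _ _ hw)

theorem seen_of_prefix (h : Consistent S obs) {v w : List A} (hw : Seen obs w) (hv : v <+: w) :
    Seen obs v := by
  obtain ⟨z, rfl⟩ := hv
  exact h.seen_of_append hw

theorem exists_step (h : Consistent S obs) {w : List A} {a : A} {o : O}
    (hw : obs (w ++ [a]) = some o) :
    ∃ s s', S.target S.init w = some s ∧ S.step s a = some (s', o) := by
  obtain ⟨v, b, s, s', hv, hs, hs'⟩ := h.sound _ _ hw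
  obtain ⟨rfl, rfl⟩ : w = v ∧ a = b := by simpa using List.append_inj' hv rfl
  exact ⟨s, s', hs, hs'⟩

theorem exists_target (h : Consistent S obs) {w : List A} (hw : Seen obs w) :
    ∃ s, S.target S.init w = some s := by
  rcases List.eq_nil_or_concat w with rfl | ⟨v, a, rfl⟩
  · exact ⟨_, rfl⟩
  · rw [List.concat_eq_append] at hw ⊢
    rcases hw with hw | hw
    · simp at hw
    · obtain ⟨o, ho⟩ := Option.ne_none_iff_exists'.1 hw
      obtain ⟨s, s', hs, hs'⟩ := h.exists_step ho
      exact ⟨s', by rw [PartialMealy.target_append, hs, Option.bind_some,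
        PartialMealy.target_singleton, hs', Option.map_some]⟩

theorem isWord (h : Consistent S obs) {w : List A} (hw : Seen obs w) : S.IsWord w := by
  obtain ⟨u, hu⟩ := PartialMealy.target_isSome_iff.1 (h.exists_target hw)
  exact PartialMealy.isWord_of_output hu

theorem step_eq_some_iff (h : Consistent S obs) {q r : List A} {a : A} {o : O} :
    (obsTree S.alphabet obs).step q a = some (r, o) ↔ r = q ++ [a] ∧ obs (q ++ [a]) = some o := by
  simp only [obsTree]
  constructor
  · intro hs
    split_ifs at hs with ha
    obtain ⟨o', ho, he⟩ := Option.map_eq_some_iff.1 hs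
    obtain ⟨rfl, rfl⟩ := Prod.mk.inj he
    exact ⟨rfl, ho⟩
  · rintro ⟨rfl, ho⟩
    have ha : a ∈ S.alphabet := h.isWord (w := q ++ [a]) (Or.inr (by simp [ho])) a (by simp)
    rw [if_pos ha, ho]
    rfl

/-- A node of the tree behaves as `S` does after its access sequence, as far as observed. This turns
tree notions into statements about `Seen` and `S.outputAfter`. Only `Seen` depends on the
observations, so apartness persists as the tree grows. -/
theorem run_eq_some_iff (h : Consistent S obs) {q r σ : List A} {u : List O} (hq : Seen obs q) :
    (obsTree S.alphabet obs).run q σ = some (r, u) ↔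
      r = q ++ σ ∧ Seen obs (q ++ σ) ∧ S.outputAfter q σ = some u := by
  induction σ generalizing q u with
  | nil =>
    obtain ⟨s, hs⟩ := h.exists_target hq
    simp [PartialMealy.run, PartialMealy.outputAfter, hs, PartialMealy.output_nil, hq, eq_comm]
  | cons a σ ih =>
    have hsplit : q ++ a :: σ = q ++ [a] ++ σ := by simp
    simp only [PartialMealy.run, Option.bind_eq_some_iff, Option.map_eq_some_iff, Prod.exists]
    constructor
    · rintro ⟨r', o, hstep, r'', u', hrun, he⟩
      obtain ⟨rfl, ho⟩ := h.step_eq_some_iff.1 hstep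
      obtain ⟨rfl, rfl⟩ := Prod.mk.inj he
      obtain ⟨rfl, hseen, hout⟩ := (ih (Or.inr (by simp [ho]))).1 hrun
      refine ⟨hsplit.symm, hsplit ▸ hseen, ?_⟩
      obtain ⟨s, s', hs, hs'⟩ := h.exists_step ho
      simp only [PartialMealy.outputAfter, PartialMealy.target_append, hs, Option.bind_some,
        PartialMealy.target_singleton, hs', Option.map_some] at hout
      simp [PartialMealy.outputAfter, hs, PartialMealy.output_cons, hs', hout]
    · rintro ⟨rfl, hseen, hout⟩
      rw [hsplit] at hseen
      have hqa : Seen obs (q ++ [a]) := h.seen_of_append hseen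
      have hne : obs (q ++ [a]) ≠ none := hqa.resolve_left (by simp)
      obtain ⟨o, ho⟩ := Option.ne_none_iff_exists'.1 hne
      obtain ⟨s, s', hs, hs'⟩ := h.exists_step ho
      simp only [PartialMealy.outputAfter, hs, Option.bind_some, PartialMealy.output_cons, hs',
        Option.map_eq_some_iff] at hout
      obtain ⟨u', hu', rfl⟩ := hout
      refine ⟨q ++ [a], o, h.step_eq_some_iff.2 ⟨rfl, ho⟩, q ++ a :: σ, u', ?_, rfl⟩
      refine (ih hqa).2 ⟨hsplit, hseen, ?_⟩
      simp [PartialMealy.outputAfter, PartialMealy.target_append, hs,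
        PartialMealy.target_singleton, hs', hu']

theorem exists_outputAfter (h : Consistent S obs) {q σ : List A} (hσ : Seen obs (q ++ σ)) :
    ∃ u, S.outputAfter q σ = some u := by
  obtain ⟨s, hs⟩ := h.exists_target hσ
  rw [PartialMealy.target_append, Option.bind_eq_some_iff] at hs
  obtain ⟨t, ht, hs⟩ := hs
  obtain ⟨u, hu⟩ := PartialMealy.target_isSome_iff.1 ⟨s, hs⟩
  exact ⟨u, by rw [PartialMealy.outputAfter, ht]; exact hu⟩

theorem target_eq_some_iff (h : Consistent S obs) {q r σ : List A} (hq : Seen obs q) :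
    (obsTree S.alphabet obs).target q σ = some r ↔ r = q ++ σ ∧ Seen obs (q ++ σ) := by
  simp only [PartialMealy.target, Option.map_eq_some_iff, Prod.exists, exists_and_right,
    exists_eq_right, h.run_eq_some_iff hq]
  constructor
  · rintro ⟨u, h1, h2, -⟩
    exact ⟨h1, h2⟩
  · rintro ⟨h1, h2⟩
    obtain ⟨u, hu⟩ := h.exists_outputAfter h2
    exact ⟨u, h1, h2, hu⟩

theorem target_eq_none_iff (h : Consistent S obs) {q σ : List A} (hq : Seen obs q) :
    (obsTree S.alphabet obs).target q σ = none ↔ ¬ Seen obs (q ++ σ) := by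
  rw [Option.eq_none_iff_forall_ne_some]
  constructor
  · intro hn hs
    exact hn _ ((h.target_eq_some_iff hq).2 ⟨rfl, hs⟩)
  · intro hs r hr
    exact hs ((h.target_eq_some_iff hq).1 hr).2

theorem output_eq_some_iff (h : Consistent S obs) {q σ : List A} {u : List O} (hq : Seen obs q) :
    (obsTree S.alphabet obs).output q σ = some u ↔
      Seen obs (q ++ σ) ∧ S.outputAfter q σ = some u := by
  simp only [PartialMealy.output, Option.map_eq_some_iff, Prod.exists, exists_eq_right,
    h.run_eq_some_iff hq, exists_eq_left]

theorem separates_iff (h : Consistent S obs) {q q' σ : List A} (hq : Seen obs q)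
    (hq' : Seen obs q') :
    Separates (obsTree S.alphabet obs) q (obsTree S.alphabet obs) q' σ ↔
      Seen obs (q ++ σ) ∧ Seen obs (q' ++ σ) ∧ S.outputAfter q σ ≠ S.outputAfter q' σ := by
  simp only [Separates, h.output_eq_some_iff hq, h.output_eq_some_iff hq']
  constructor
  · rintro ⟨u, v, ⟨h1, hu⟩, ⟨h2, hv⟩, huv⟩
    refine ⟨h1, h2, ?_⟩
    rw [hu, hv]
    exact fun he => huv (Option.some.inj he)
  · rintro ⟨h1, h2, hne⟩
    obtain ⟨u, hu⟩ := h.exists_outputAfter h1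
    obtain ⟨v, hv⟩ := h.exists_outputAfter h2
    exact ⟨u, v, ⟨h1, hu⟩, ⟨h2, hv⟩, fun he => hne (by rw [hu, hv, he])⟩

theorem apart_iff (h : Consistent S obs) {q q' : List A} (hq : Seen obs q) (hq' : Seen obs q') :
    Apart (obsTree S.alphabet obs) q (obsTree S.alphabet obs) q' ↔
      ∃ σ, Seen obs (q ++ σ) ∧ Seen obs (q' ++ σ) ∧ S.outputAfter q σ ≠ S.outputAfter q' σ := by
  simp only [Apart, h.separates_iff hq hq']

theorem apart_mono (h : Consistent S obs) (h' : Consistent S obs')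
    (hle : ∀ w, Seen obs w → Seen obs' w) {q q' : List A} (hq : Seen obs q) (hq' : Seen obs q')
    (ha : Apart (obsTree S.alphabet obs) q (obsTree S.alphabet obs) q') :
    Apart (obsTree S.alphabet obs') q (obsTree S.alphabet obs') q' := by
  rw [h.apart_iff hq hq'] at ha
  rw [h'.apart_iff (hle _ hq) (hle _ hq')]
  obtain ⟨σ, h1, h2, h3⟩ := ha
  exact ⟨σ, hle _ h1, hle _ h2, h3⟩

theorem apart_reference_mono {Q' : Type*} {R : PartialMealy Q' A O} {p : Q'}
    (h : Consistent S obs) (h' : Consistent S obs')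
    (hle : ∀ w, Seen obs w → Seen obs' w) {q : List A} (hq : Seen obs q)
    (ha : Apart (obsTree S.alphabet obs) q R p) : Apart (obsTree S.alphabet obs') q R p := by
  obtain ⟨σ, u, v, hu, hv, huv⟩ := ha
  rw [h.output_eq_some_iff hq] at hu
  exact ⟨σ, u, v, (h'.output_eq_some_iff (hle _ hq)).2 ⟨hle _ hu.1, hu.2⟩, hv, huv⟩

theorem mem_frontier_iff (h : Consistent S obs) {B : Finset (List A)} (hB : ∀ q ∈ B, Seen obs q)
    {r : List A} :
    r ∈ Frontier (obsTree S.alphabet obs) B ↔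
      r ∉ B ∧ ∃ q ∈ B, ∃ i, r = q ++ [i] ∧ Seen obs r := by
  simp only [Frontier, Set.mem_ofPred_eq]
  refine and_congr_right fun _ => ⟨?_, ?_⟩
  · rintro ⟨q, hq, i, hi⟩
    obtain ⟨rfl, hs⟩ := (h.target_eq_some_iff (hB q hq)).1 hi
    exact ⟨q, hq, i, rfl, hs⟩
  · rintro ⟨q, hq, i, rfl, hs⟩
    exact ⟨q, hq, i, (h.target_eq_some_iff (hB q hq)).2 ⟨rfl, hs⟩⟩

end Consistent

/-! ### The effect of an output query on the observations. -/

theorem seen_record_iff {w v : List A} {u : List O} (hu : u.length = w.length) :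
    Seen (record obs w u) v ↔ Seen obs v ∨ v <+: w := by
  unfold Seen record
  by_cases hv : v = []
  · simp [hv]
  · by_cases hp : v <+: w
    · have h1 := hp.length_le
      have h2 : 0 < v.length := List.length_pos_iff.2 hv
      have h3 : v.length - 1 < u.length := by omega
      simp [hv, hp, h3]
    · simp [hv, hp]

theorem seen_outputQuery_iff (hS : S.IsComplete) {w v : List A} (hw : S.IsWord w) :
    Seen (outputQuery S obs w) v ↔ Seen obs v ∨ v <+: w := by
  obtain ⟨u, hu⟩ := hS.exists_output S.init hw
  rw [outputQuery, hu]
  exact seen_record_iff (PartialMealy.length_of_output hu)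

theorem seen_outputQuery_of_seen (hS : S.IsComplete) {w v : List A} (hw : S.IsWord w)
    (hv : Seen obs v) : Seen (outputQuery S obs w) v :=
  (seen_outputQuery_iff hS hw).2 (Or.inl hv)

theorem seen_outputQuery_self (hS : S.IsComplete) {w : List A} (hw : S.IsWord w) :
    Seen (outputQuery S obs w) w :=
  (seen_outputQuery_iff hS hw).2 (Or.inr List.prefix_rfl)

theorem Consistent.outputQuery (h : Consistent S obs) (w : List A) :
    Consistent S (outputQuery S obs w) := by
  rcases hu : S.output S.init w with _ | u
  · simpa only [_root_.outputQuery, hu] using h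
  have hlen := PartialMealy.length_of_output hu
  simp only [_root_.outputQuery, hu]
  constructor
  · intro v a hva
    have hs : Seen (record obs w u) (v ++ [a]) := Or.inr hva
    rw [seen_record_iff hlen] at hs ⊢
    rcases hs with hs | hs
    · exact Or.inl (h.seen_of_append hs)
    · exact Or.inr ((List.prefix_append v [a]).trans hs)
  · intro v o ho
    unfold record at ho
    split_ifs at ho with hv
    · obtain ⟨hv0, z, rfl⟩ := hv
      rcases List.eq_nil_or_concat v with rfl | ⟨x, a, rfl⟩
      · exact absurd rfl hv0
      simp only [List.concat_eq_append, List.length_append, List.length_singleton,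
        Nat.add_sub_cancel] at ho hu ⊢
      rw [List.append_assoc, PartialMealy.output_append, Option.bind_eq_some_iff] at hu
      obtain ⟨u1, hu1, hu⟩ := hu
      rw [Option.bind_eq_some_iff] at hu
      obtain ⟨s, hs, hu⟩ := hu
      rw [List.singleton_append, PartialMealy.output_cons, Option.map_eq_some_iff] at hu
      obtain ⟨u2, hu2, rfl⟩ := hu
      rw [Option.bind_eq_some_iff] at hu2
      obtain ⟨⟨s', o'⟩, hstep, hu2⟩ := hu2
      obtain ⟨u3, -, rfl⟩ := Option.map_eq_some_iff.1 hu2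
      have hl := PartialMealy.length_of_output hu1
      -- The entry at index `x.length` is the first one after the outputs on `x`, which is `o'`.
      rw [← hl] at ho
      simp at ho
      subst ho
      exact ⟨x, a, s, s', rfl, hs, hstep⟩
    · exact h.sound v o ho

theorem consistent_none (S : PartialMealy Q A O) : Consistent S (fun _ => none) :=
  ⟨fun _ _ h => absurd rfl h, fun _ _ h => by simp at h⟩

end Observations

/-! ## The basis and the hypothesis -/

/-- The basis `B` is a subtree containing the root. -/
structure IsSubtree {A O : Type*} (obs : List A → Option O) (B : Finset (List A)) : Prop where
  nil_mem : [] ∈ B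
  init_mem : ∀ q a, q ++ [a] ∈ B → q ∈ B
  seen : ∀ q ∈ B, Seen obs q

section Hypothesis

variable {Q A O : Type*} {S : PartialMealy Q A O} {obs obs' : List A → Option O}
  {B : Finset (List A)} {H : PartialMealy B A O}

namespace IsSubtree

theorem mono (hB : IsSubtree obs B) (hle : ∀ w, Seen obs w → Seen obs' w) : IsSubtree obs' B :=
  ⟨hB.nil_mem, hB.init_mem, fun q hq => hle q (hB.seen q hq)⟩

theorem mem_of_prefix (hB : IsSubtree obs B) {v w : List A} (hw : w ∈ B) (hv : v <+: w) :
    v ∈ B := by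
  obtain ⟨z, rfl⟩ := hv
  induction z using List.reverseRecOn with
  | nil => simpa using hw
  | append_singleton z a ih =>
    rw [← List.append_assoc] at hw
    exact ih (hB.init_mem _ _ hw)

open Classical in
-- The `q.length + 1` prefixes of `q` are distinct elements of the prefix-closed set `B`.
theorem length_lt_card (hB : IsSubtree obs B) {q : List A} (hq : q ∈ B) : q.length < B.card := by
  have hsub : (Finset.range (q.length + 1)).image (fun j => q.take j) ⊆ B := by
    intro v hv
    obtain ⟨j, -, rfl⟩ := Finset.mem_image.1 hv
    exact hB.mem_of_prefix hq (List.take_prefix j q)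
  have hcard := Finset.card_le_card hsub
  rw [Finset.card_image_of_injOn, Finset.card_range] at hcard
  · omega
  · intro a ha b hb hab
    simp only [Finset.coe_range, Set.mem_Iio] at ha hb
    have := congrArg List.length hab
    simp only [List.length_take] at this
    omega

/-- Every proper prefix of a frontier state lies in the basis, so the frontier is an antichain for
the prefix order. -/
theorem frontier_prefix_unique (h : Consistent S obs) (hB : IsSubtree obs B) {r r' w : List A}
    (hr : r ∈ Frontier (obsTree S.alphabet obs) B) (hr' : r' ∈ Frontier (obsTree S.alphabet obs) B)
    (hrw : r <+: w) (hrw' : r' <+: w) : r = r' := by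
  have key : ∀ {r r' : List A}, r ∈ Frontier (obsTree S.alphabet obs) B →
      r' ∈ Frontier (obsTree S.alphabet obs) B → r <+: r' → r = r' := by
    intro r r' hr hr' hp
    obtain ⟨hrB, -⟩ := (h.mem_frontier_iff hB.seen).1 hr
    obtain ⟨-, q, hq, i, rfl, -⟩ := (h.mem_frontier_iff hB.seen).1 hr'
    rcases List.prefix_concat_iff.1 hp with h | h
    · exact h
    · exact absurd (hB.mem_of_prefix hq h) hrB
  rcases List.prefix_or_prefix_of_prefix hrw hrw' with hp | hp
  · exact key hr hr' hp
  · exact (key hr' hr hp).symm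

theorem exists_frontier_prefix (h : Consistent S obs) (hB : IsSubtree obs B) {w : List A}
    (hw : Seen obs w) (hwB : w ∉ B) :
    ∃ r ∈ Frontier (obsTree S.alphabet obs) B, r <+: w := by
  induction w using List.reverseRecOn with
  | nil => exact absurd hB.nil_mem hwB
  | append_singleton w a ih =>
    by_cases hmem : w ∈ B
    · exact ⟨w ++ [a], (h.mem_frontier_iff hB.seen).2 ⟨hwB, w, hmem, a, rfl, hw⟩, List.prefix_rfl⟩
    · obtain ⟨r, hr, hp⟩ := ih (h.seen_of_append hw) hmem
      exact ⟨r, hr, hp.trans (List.prefix_append _ _)⟩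

end IsSubtree

namespace IsHypothesis

theorem isComplete {T : PartialMealy (List A) A O} (hH : IsHypothesis T B H) : H.IsComplete := by
  intro q a ha
  obtain ⟨r, o, q', -, hs, -⟩ := hH.2.2 q a (hH.1 ▸ ha)
  exact ⟨_, hs⟩

/-- Transitions inside the basis are not redirected, and the basis is prefix-closed. -/
theorem target_basis (h : Consistent S obs) (hB : IsSubtree obs B)
    (hH : IsHypothesis (obsTree S.alphabet obs) B H) {w : List A} (hw : w ∈ B) :
    H.target H.init w = some ⟨w, hw⟩ := by
  induction w using List.reverseRecOn with
  | nil => rw [PartialMealy.target_nil]; exact congrArg some (Subtype.ext hH.2.1)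
  | append_singleton w a ih =>
    have hmem := hB.init_mem _ _ hw
    have ha : a ∈ S.alphabet := h.isWord (hB.seen _ hw) a (by simp)
    obtain ⟨r, o, q', hT, hs, hq'⟩ := hH.2.2 ⟨w, hmem⟩ a ha
    obtain ⟨rfl, -⟩ := h.step_eq_some_iff.1 hT
    rw [PartialMealy.target_append, ih hmem, Option.bind_some, PartialMealy.target_singleton, hs]
    rcases hq' with hq' | hq'
    · exact congrArg some (Subtype.ext hq'.symm)
    · exact absurd hw hq'.1

theorem target_frontier (h : Consistent S obs) (hB : IsSubtree obs B)
    (hH : IsHypothesis (obsTree S.alphabet obs) B H) {q : List A} {a : A} (hq : q ∈ B)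
    (ha : a ∈ S.alphabet) (hr : q ++ [a] ∉ B) {p : B}
    (hp : H.target H.init (q ++ [a]) = some p) :
    Seen obs (q ++ [a]) ∧ IdentifiedWith (obsTree S.alphabet obs) B (q ++ [a]) p := by
  obtain ⟨r, o, q', hT, hs, hq'⟩ := hH.2.2 ⟨q, hq⟩ a ha
  obtain ⟨rfl, ho⟩ := h.step_eq_some_iff.1 hT
  rw [PartialMealy.target_append, target_basis h hB hH hq, Option.bind_some,
    PartialMealy.target_singleton, hs, Option.map_some, Option.some_inj] at hp
  subst hp
  rcases hq' with hq' | hq'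
  · exact absurd (hq' ▸ q'.2 : q ++ [a] ∈ B) hr
  · exact ⟨Or.inr (by simp [ho]), hq'.2⟩

end IsHypothesis

open Classical in
theorem Adequate.exists_isHypothesis (h : Consistent S obs) (hB : IsSubtree obs B)
    (hT : Adequate (obsTree S.alphabet obs) B) :
    ∃ H : PartialMealy B A O, IsHypothesis (obsTree S.alphabet obs) B H := by
  have hex : ∀ (q : B) (a : A), a ∈ S.alphabet → ∃ x : B × O,
      ∃ r, (obsTree S.alphabet obs).step q a = some (r, x.2) ∧
        (r = x.1 ∨ (r ∉ B ∧ IdentifiedWith (obsTree S.alphabet obs) B r x.1)) := by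
    intro q a ha
    obtain ⟨⟨r, o⟩, hs⟩ := hT.1 q q.2 a ha
    by_cases hr : r ∈ B
    · exact ⟨(⟨r, hr⟩, o), r, hs, Or.inl rfl⟩
    · obtain ⟨rfl, ho⟩ := h.step_eq_some_iff.1 hs
      obtain ⟨p, hp⟩ := hT.2 _ ((h.mem_frontier_iff hB.seen).2
        ⟨hr, q, q.2, a, rfl, Or.inr (by simp [ho])⟩)
      exact ⟨(⟨p, hp.1⟩, o), _, hs, Or.inr ⟨hr, hp⟩⟩
  choose f hf using hex
  refine ⟨⟨S.alphabet, ⟨[], hB.nil_mem⟩,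
    fun q a => if ha : a ∈ S.alphabet then some (f q a ha) else none, ?_⟩, rfl, rfl, ?_⟩
  · intro q a x hx
    by_contra ha
    simp [ha] at hx
  · intro q a ha
    obtain ⟨r, hs, hr⟩ := hf q a ha
    have ha' : a ∈ S.alphabet := ha
    exact ⟨r, (f q a ha).2, (f q a ha).1, hs, by simp [ha'], hr⟩

/-- Up to the first wrong symbol `a` the sequence leads to a basis state whose output on `a` is
copied from the tree. Hence `[a]` separates that basis state from the tree state. The hypothesis
comes from `obs`, while the wrong output is observed in the larger `obs'`. -/
theorem IsHypothesis.exists_conflict (h : Consistent S obs)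
    (hB : IsSubtree obs B) (hH : IsHypothesis (obsTree S.alphabet obs) B H)
    (h' : Consistent S obs') (hle : ∀ w, Seen obs w → Seen obs' w) {w : List A}
    (hw : Seen obs' w) (hne : H.output H.init w ≠ S.output S.init w) :
    ∃ τ, τ <+: w ∧ Conflict (obsTree S.alphabet obs') H τ := by
  induction w using List.reverseRecOn with
  | nil => exact absurd rfl hne
  | append_singleton w a ih =>
    by_cases hw' : H.output H.init w = S.output S.init w
    · refine ⟨w, List.prefix_append _ _, ?_⟩
      have hword := h'.isWord hw
      have hseen := h'.seen_of_append hw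
      have hHw : H.IsWord w := fun b hb => hH.1 ▸ hword b (by simp [hb])
      obtain ⟨q, hq⟩ := hH.isComplete.exists_target H.init hHw
      refine ⟨q, w, hq, (h'.target_eq_some_iff seen_nil).2 ⟨rfl, hseen⟩, ?_⟩
      rw [h'.apart_iff (hle _ (hB.seen _ q.2)) hseen]
      have ha : a ∈ S.alphabet := hword a (by simp)
      obtain ⟨r, o, q', hT, hs, -⟩ := hH.2.2 q a ha
      obtain ⟨rfl, ho⟩ := h.step_eq_some_iff.1 hT
      refine ⟨[a], hle _ (Or.inr (by simp [ho])), hw, fun he => hne ?_⟩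
      obtain ⟨s, s', h1, h2⟩ := h.exists_step ho
      obtain ⟨t, ht⟩ := h'.exists_target hseen
      simp only [PartialMealy.outputAfter, h1, ht, Option.bind_some,
        PartialMealy.output_singleton, h2, Option.map_some] at he
      simp only [PartialMealy.output_append, hw', hq, ht, Option.bind_some,
        PartialMealy.output_singleton, hs, ← he, Option.map_some]
    · obtain ⟨τ, hτ, hc⟩ := ih (h'.seen_of_append hw) hw'
      exact ⟨τ, hτ.trans (List.prefix_append _ _), hc⟩

/-! ## Processing a conflict -/

/-- The sequence `σ` leads the hypothesis and the tree to apart states. -/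
def ConflictAt {Q A O : Type*} (S : PartialMealy Q A O) {B : Finset (List A)}
    (H : PartialMealy B A O) (obs : List A → Option O) (σ : List A) : Prop :=
  Seen obs σ ∧ ∃ q : B, H.target H.init σ = some q ∧
    Apart (obsTree S.alphabet obs) (q : List A) (obsTree S.alphabet obs) σ

theorem Consistent.conflict_iff (h : Consistent S obs) {σ : List A} :
    Conflict (obsTree S.alphabet obs) H σ ↔ ConflictAt S H obs σ := by
  constructor
  · rintro ⟨q, r, hq, hr, ha⟩
    obtain ⟨rfl, hs⟩ := (h.target_eq_some_iff (q := []) seen_nil).1 hr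
    exact ⟨hs, q, hq, ha⟩
  · rintro ⟨hs, q, hq, ha⟩
    exact ⟨q, σ, hq, (h.target_eq_some_iff (q := []) seen_nil).2 ⟨rfl, hs⟩, ha⟩

/-- The facts about one split of a conflict `σ` at position `j` of its binary search. -/
theorem ConflictAt.split (hS : S.IsComplete) {obs₀ : List A → Option O}
    (h₀ : Consistent S obs₀) (hB₀ : IsSubtree obs₀ B)
    (hH : IsHypothesis (obsTree S.alphabet obs₀) B H) (h : Consistent S obs)
    (hB : IsSubtree obs B) {σ η : List A} {q q' : B} {j : ℕ}
    (hσ : Seen obs σ) (hq : H.target H.init σ = some q)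
    (hq' : H.target H.init (σ.take j) = some q')
    (hη : Separates (obsTree S.alphabet obs) (q : List A) (obsTree S.alphabet obs) σ η)
    (hobs' : obs' = outputQuery S obs (q' ++ σ.drop j ++ η)) :
    Consistent S obs' ∧ (∀ w, Seen obs w → Seen obs' w) ∧
      (∀ w, Seen obs' w → Seen obs w ∨
        w.length ≤ (q' : List A).length + (σ ++ η).length) ∧ Seen obs (σ ++ η) ∧
      (Apart (obsTree S.alphabet obs') (q' : List A) (obsTree S.alphabet obs') (σ.take j) →
        ConflictAt S H obs' (σ.take j)) ∧
      (¬ Apart (obsTree S.alphabet obs') (q' : List A) (obsTree S.alphabet obs') (σ.take j) →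
        ConflictAt S H obs' (q' ++ σ.drop j)) := by
  rw [h.separates_iff (hB.seen _ q.2) hσ] at hη
  obtain ⟨hη1, hη2, hη3⟩ := hη
  have hword : S.IsWord (q' ++ σ.drop j ++ η) := by
    have h1 := h.isWord hη2
    have h2 := h.isWord (hB.seen _ q'.2)
    intro a ha
    simp only [List.mem_append] at ha
    rcases ha with (ha | ha) | ha
    · exact h2 a ha
    · exact h1 a (List.mem_append_left _ (List.mem_of_mem_drop ha))
    · exact h1 a (List.mem_append_right _ ha)
  subst hobs'
  have h' := h.outputQuery (q' ++ σ.drop j ++ η)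
  have hle : ∀ w, Seen obs w → Seen (outputQuery S obs (q' ++ σ.drop j ++ η)) w :=
    fun w hw => seen_outputQuery_of_seen hS hword hw
  have hnew := seen_outputQuery_self (obs := obs) hS hword
  have htake : Seen obs (σ.take j) := h.seen_of_prefix hσ (List.take_prefix j σ)
  refine ⟨h', hle, ?_, hη2, ?_, ?_⟩
  · intro w hw
    refine ((seen_outputQuery_iff hS hword).1 hw).imp_right fun hp => hp.length_le.trans ?_
    simp only [List.length_append, List.length_drop]
    omega
  · intro ha
    exact ⟨hle _ htake, q', hq', ha⟩
  · intro ha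
    refine ⟨h'.seen_of_append hnew, q, ?_, ?_⟩
    -- `H` reaches `q'` both on its access sequence and on `σ.take j`, so appending `σ.drop j` leads
    -- to the same state `q`.
    · rw [← hq]
      conv_rhs => rw [← List.take_append_drop j σ]
      rw [PartialMealy.target_append, PartialMealy.target_append, hq',
        IsHypothesis.target_basis h₀ hB₀ hH q'.2]
    · rw [h'.apart_iff (hle _ (hB.seen _ q.2)) (h'.seen_of_append hnew)]
      -- If `η` did not separate `q` from `q' ++ σ.drop j`, the latter would differ from `σ` on `η`.
      -- Then `σ.drop j ++ η` would separate `q'` from `σ.take j`.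
      refine ⟨η, hle _ hη1, hnew, fun he => hη3 (he.trans ?_)⟩
      by_contra hne
      refine ha ((h'.apart_iff (hle _ (hB.seen _ q'.2)) (hle _ htake)).2
        ⟨σ.drop j ++ η, by rwa [← List.append_assoc], ?_, fun heq => hne ?_⟩)
      · rw [← List.append_assoc, List.take_append_drop]
        exact hle _ hη2
      · rw [PartialMealy.outputAfter_append, PartialMealy.outputAfter_append,
          List.take_append_drop] at heq
        obtain ⟨u1, hu1⟩ := hS.exists_outputAfter
          (hword.of_prefix (List.prefix_append ((q' : List A) ++ σ.drop j) η))
        obtain ⟨u2, hu2⟩ := hS.exists_outputAfter hword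
        obtain ⟨v1, hv1⟩ := hS.exists_outputAfter (w := σ.take j) (σ := σ.drop j)
          (by rw [List.take_append_drop]; exact h.isWord hσ)
        obtain ⟨v2, hv2⟩ := h.exists_outputAfter hη2
        rw [hu1, hv1, hu2, hv2, Option.bind_some, Option.bind_some, Option.map_some,
          Option.map_some, Option.some_inj] at heq
        -- The outputs on `σ.drop j` have equal lengths, so equal concatenations have equal parts on
        -- `η`.
        have hlen : u1.length = v1.length := by
          obtain ⟨s, -, hs⟩ := Option.bind_eq_some_iff.1 hu1
          obtain ⟨t, -, ht⟩ := Option.bind_eq_some_iff.1 hv1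
          rw [PartialMealy.length_of_output hs, PartialMealy.length_of_output ht]
        rw [hu2, hv2, (List.append_inj heq hlen).2]

theorem ConflictAt.not_mem_basis (h : Consistent S obs) (hB : IsSubtree obs B)
    (hH : IsHypothesis (obsTree S.alphabet obs) B H) {σ : List A} (hσ : ConflictAt S H obs' σ) :
    σ ∉ B := by
  intro hmem
  obtain ⟨-, q, hq, ha⟩ := hσ
  rw [IsHypothesis.target_basis h hB hH hmem, Option.some_inj] at hq
  subst hq
  exact not_apart_self ha

/-- The binary size is the cost measure of the search: each halving pays for one query. -/
theorem size_half_lt {d : ℕ} (hd : 0 < d) : (d / 2).size < d.size := by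
  rw [Nat.lt_size]
  rcases h : (d / 2).size with _ | m
  · rwa [pow_zero]
  · have := Nat.lt_size.1 (show m < (d / 2).size by omega)
    rw [pow_succ]
    omega

/-- Processing a conflict ends with a conflict in the frontier; its cost is logarithmic in the
length of the conflict beyond the frontier. -/
theorem ProcCounterEx.spec (hS : S.IsComplete) {obs₀ : List A → Option O}
    (h₀ : Consistent S obs₀) (hB₀ : IsSubtree obs₀ B)
    (hH : IsHypothesis (obsTree S.alphabet obs₀) B H) {σ : List A} {c N : ℕ}
    (hN : ∀ q ∈ B, q.length ≤ N) (hp : ProcCounterEx S H obs σ obs' c) :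
    Consistent S obs → IsSubtree obs B → ConflictAt S H obs σ →
    Consistent S obs' ∧ (∀ w, Seen obs w → Seen obs' w) ∧
      (∃ r ∈ Frontier (obsTree S.alphabet obs') B, ConflictAt S H obs' r) ∧
      (∀ ρ ∈ Frontier (obsTree S.alphabet obs) B, ρ <+: σ → c ≤ (σ.length - ρ.length).size) ∧
      ∀ D, (∀ w, Seen obs w → w.length ≤ D) → ∀ w, Seen obs' w → w.length ≤ D + N * c := by
  induction hp with
  | finish obs σ hfin =>
    intro h hB hc
    have hF := hfin.resolve_left (hc.not_mem_basis h₀ hB₀ hH)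
    exact ⟨h, fun _ hw => hw, ⟨σ, hF, hc⟩, fun _ _ _ => Nat.zero_le _,
      fun D hD w hw => by simpa using hD w hw⟩
  | left obs obs' obs'' σ ρ η q q' j c hnot hρσ hρ hj hq hq' hη hobs' ha hp ih =>
    intro h hB hc
    obtain ⟨h', hle, hdepth, hση, hl, -⟩ :=
      ConflictAt.split hS h₀ hB₀ hH h hB hc.1 hq hq' hη hobs'
    obtain ⟨h'', hle', hr, hcost, hdepth'⟩ := ih h' (hB.mono hle) (hl ha)
    have hne : ρ ≠ σ := by rintro rfl; exact hnot (Or.inr hρ)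
    have hlt : ρ.length < σ.length := by
      refine lt_of_le_of_ne hρσ.length_le fun he => hne (hρσ.eq_of_length he)
    refine ⟨h'', fun w hw => hle' w (hle w hw), hr, ?_, ?_⟩
    · intro ρ' hρ' hρσ'
      obtain rfl := hB.frontier_prefix_unique h hρ hρ' hρσ hρσ'
      have hρ2 : ρ ∈ Frontier (obsTree S.alphabet obs') B := by
        rw [h.mem_frontier_iff hB.seen] at hρ
        rw [h'.mem_frontier_iff (hB.mono hle).seen]
        obtain ⟨h1, p, hp, i, h2, h3⟩ := hρ
        exact ⟨h1, p, hp, i, h2, hle _ h3⟩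
      have hpre : ρ <+: σ.take j := List.prefix_take_iff.2 ⟨hρσ, by omega⟩
      have h1 := hcost ρ hρ2 hpre
      rw [List.length_take] at h1
      -- The frontier prefix is still `ρ`; the part beyond it is halved, rounded down.
      have h2 : min j σ.length - ρ.length = (σ.length - ρ.length) / 2 := by omega
      rw [h2] at h1
      have h3 := size_half_lt (show 0 < σ.length - ρ.length by omega)
      omega
    · intro D hD w hw
      have := hdepth' (D + N) (fun w hw => (hdepth w hw).elim (fun hs => (hD w hs).trans
        (Nat.le_add_right _ _)) fun hl => hl.trans (by
          have h1 := hN _ q'.2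
          have h2 := hD _ hση
          omega)) w hw
      rw [Nat.mul_add, Nat.mul_one]
      omega
  | right obs obs' obs'' σ ρ η q q' j c hnot hρσ hρ hj hq hq' hη hobs' ha hp ih =>
    intro h hB hc
    obtain ⟨h', hle, hdepth, hση, -, hr⟩ :=
      ConflictAt.split hS h₀ hB₀ hH h hB hc.1 hq hq' hη hobs'
    obtain ⟨h'', hle', hr', hcost, hdepth'⟩ := ih h' (hB.mono hle) (hr ha)
    have hne : ρ ≠ σ := by rintro rfl; exact hnot (Or.inr hρ)
    have hlt : ρ.length < σ.length := by
      refine lt_of_le_of_ne hρσ.length_le fun he => hne (hρσ.eq_of_length he)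
    refine ⟨h'', fun w hw => hle' w (hle w hw), hr', ?_, ?_⟩
    · intro ρ' hρ' hρσ'
      obtain rfl := hB.frontier_prefix_unique h hρ hρ' hρσ hρσ'
      obtain ⟨ρ₂, hρ₂, hpre⟩ := (hB.mono hle).exists_frontier_prefix h' (hr ha).1
        ((hr ha).not_mem_basis h₀ hB₀ hH)
      -- The new frontier prefix leaves the basis, so it exceeds `q'` by at least one symbol. This
      -- symbol makes up for the rounding when the part beyond the frontier has odd length.
      have hlen : (q' : List A).length < ρ₂.length := by
        by_contra hcon
        have := List.prefix_of_prefix_length_le hpre (List.prefix_append (q' : List A) _)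
          (not_lt.1 hcon)
        exact ((h'.mem_frontier_iff (hB.mono hle).seen).1 hρ₂).1
          (hB.mem_of_prefix q'.2 this)
      have h1 := hcost ρ₂ hρ₂ hpre
      rw [List.length_append, List.length_drop] at h1
      have h2 := Nat.size_le_size (show (q' : List A).length + (σ.length - j) - ρ₂.length ≤
        (σ.length - ρ.length) / 2 by omega)
      have h3 := size_half_lt (show 0 < σ.length - ρ.length by omega)
      omega
    · intro D hD w hw
      -- The queried word is at most as long as `q'` followed by the observed word `σ ++ η`, so a
      -- query deepens the tree by at most `N`.
      have := hdepth' (D + N) (fun w hw => (hdepth w hw).elim (fun hs => (hD w hs).trans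
        (Nat.le_add_right _ _)) fun hl => hl.trans (by
          have h1 := hN _ q'.2
          have h2 := hD _ hση
          omega)) w hw
      rw [Nat.mul_add, Nat.mul_one]
      omega

/-- Shows that the equivalence rule never gets stuck: both branches of the search at least halve the
distance `d` beyond the frontier. -/
theorem ConflictAt.exists_procCounterEx (hS : S.IsComplete) {obs₀ : List A → Option O}
    (h₀ : Consistent S obs₀) (hB₀ : IsSubtree obs₀ B)
    (hH : IsHypothesis (obsTree S.alphabet obs₀) B H) (d : ℕ) :
    ∀ {obs : List A → Option O} {σ : List A}, Consistent S obs → IsSubtree obs B →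
      ConflictAt S H obs σ → (∀ ρ ∈ Frontier (obsTree S.alphabet obs) B, ρ <+: σ →
        σ.length - ρ.length ≤ d) → ∃ obs' c, ProcCounterEx S H obs σ obs' c := by
  induction d using Nat.strong_induction_on with
  | _ d ih =>
  intro obs σ h hB hc hd
  by_cases hfin : σ ∈ B ∨ σ ∈ Frontier (obsTree S.alphabet obs) B
  · exact ⟨obs, 0, .finish obs σ hfin⟩
  obtain ⟨ρ, hρ, hρσ⟩ := hB.exists_frontier_prefix h hc.1 (fun hm => hfin (Or.inl hm))
  have hne : ρ ≠ σ := by rintro rfl; exact hfin (Or.inr hρ)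
  have hlt : ρ.length < σ.length :=
    lt_of_le_of_ne hρσ.length_le fun he => hne (hρσ.eq_of_length he)
  have hdρ := hd ρ hρ hρσ
  have hc' := hc
  obtain ⟨hσ, q, hq, η, hη⟩ := hc
  set j := (ρ.length + σ.length) / 2 with hj
  obtain ⟨q', hq'⟩ : ∃ q', H.target H.init (σ.take j) = some q' := by
    have := hq
    rw [← List.take_append_drop j σ, PartialMealy.target_append, Option.bind_eq_some_iff] at this
    exact ⟨_, this.choose_spec.1⟩
  obtain ⟨h', hle, -, -, hl, hr⟩ := ConflictAt.split hS h₀ hB₀ hH h hB hσ hq hq' hη rfl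
  have hB' := hB.mono hle
  by_cases ha : Apart (obsTree S.alphabet (outputQuery S obs (q' ++ σ.drop j ++ η))) (q' : List A)
      (obsTree S.alphabet (outputQuery S obs (q' ++ σ.drop j ++ η))) (σ.take j)
  · obtain ⟨obs'', c, hp⟩ := ih (d / 2) (by omega) h' hB' (hl ha) (by
      intro ρ₂ hρ₂ hpre
      have hρ' : ρ ∈ Frontier (obsTree S.alphabet (outputQuery S obs
          (q' ++ σ.drop j ++ η))) B := by
        rw [h.mem_frontier_iff hB.seen] at hρ
        rw [h'.mem_frontier_iff hB'.seen]
        obtain ⟨h1, p, hp, i, h2, h3⟩ := hρ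
        exact ⟨h1, p, hp, i, h2, hle _ h3⟩
      obtain rfl := hB'.frontier_prefix_unique h' hρ' hρ₂ hρσ (hpre.trans (List.take_prefix _ _))
      rw [List.length_take]
      omega)
    exact ⟨obs'', c + 1, .left obs _ obs'' σ ρ η q q' j c hfin hρσ hρ hj hq hq' hη rfl ha hp⟩
  · obtain ⟨obs'', c, hp⟩ := ih (d / 2) (by omega) h' hB' (hr ha) (by
      intro ρ₂ hρ₂ hpre
      have hlen : (q' : List A).length < ρ₂.length := by
        by_contra hcon
        have := List.prefix_of_prefix_length_le hpre (List.prefix_append (q' : List A) _)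
          (not_lt.1 hcon)
        exact ((h'.mem_frontier_iff hB'.seen).1 hρ₂).1 (hB.mem_of_prefix q'.2 this)
      rw [List.length_append, List.length_drop]
      omega)
    exact ⟨obs'', c + 1, .right obs _ obs'' σ ρ η q q' j c hfin hρσ hρ hj hq hq' hη rfl ha hp⟩

end Hypothesis

/-! ## Milestones of the learner -/

/-- The facts of which each query of a rule other than the equivalence rule establishes a new one;
`F` is the type of the output functions of the reference states. -/
inductive Milestone (A F : Type*) where
  | extended (q : List A) (i : A)
  | separated (q r : List A) (i : A)
  | rebuilt (q q' : List A) (i : A)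
  | refined (q : List A) (f f' : F)
  | mismatched (q : List A) (i : A) (f : F)

section Milestones

variable {QS QR A O : Type*}

/-- The milestones achieved with given observations and basis. -/
def Achieved (S : PartialMealy QS A O) (R : PartialMealy QR A O) (K : ReferenceData R S.alphabet)
    (obs : List A → Option O) (B : Finset (List A)) :
    Milestone A (List A → Option (List O)) → Prop
  | .extended q i => q ∈ B ∧ i ∈ S.alphabet ∧ Seen obs (q ++ [i])
  | .separated q r i => q ∈ B ∧ r ∈ B ∧ i ∈ S.alphabet ∧ Seen obs (r ++ [i]) ∧
      Apart (obsTree S.alphabet obs) q (obsTree S.alphabet obs) (r ++ [i])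
  | .rebuilt q q' i => q ∈ B ∧ q' ∈ B ∧ i ∈ S.alphabet ∧
      ∃ p p', (R.restrict S.alphabet).target R.init (q ++ [i]) = some p ∧
        (R.restrict S.alphabet).target R.init q' = some p' ∧
        Seen obs (q ++ i :: K.sep p p') ∧ Seen obs (q' ++ K.sep p p')
  | .refined q f f' => q ∈ B ∧ ∃ p p', R.output p = f ∧ R.output p' = f' ∧
      Apart (R.restrict S.alphabet) p (R.restrict S.alphabet) p' ∧ Seen obs (q ++ K.sep p p')
  | .mismatched q i f => q ∈ B ∧ i ∈ S.alphabet ∧ Seen obs (q ++ [i]) ∧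
      ∃ p, R.output p = f ∧ Apart (obsTree S.alphabet obs) (q ++ [i]) R p

variable {S : PartialMealy QS A O} {R : PartialMealy QR A O} {K : ReferenceData R S.alphabet}
  {obs obs' : List A → Option O} {B B' : Finset (List A)}

theorem Achieved.mono (h : Consistent S obs) (h' : Consistent S obs')
    (hle : ∀ w, Seen obs w → Seen obs' w) (hB : ∀ q ∈ B, Seen obs q) (hBB' : B ⊆ B')
    {x : Milestone A (List A → Option (List O))} (hx : Achieved S R K obs B x) :
    Achieved S R K obs' B' x := by
  cases x with
  | extended q i => exact ⟨hBB' hx.1, hx.2.1, hle _ hx.2.2⟩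
  | separated q r i =>
    obtain ⟨h1, h2, h3, h4, h5⟩ := hx
    exact ⟨hBB' h1, hBB' h2, h3, hle _ h4, h.apart_mono h' hle (hB _ h1) h4 h5⟩
  | rebuilt q q' i =>
    obtain ⟨h1, h2, h3, p, p', h4, h5, h6, h7⟩ := hx
    exact ⟨hBB' h1, hBB' h2, h3, p, p', h4, h5, hle _ h6, hle _ h7⟩
  | refined q f f' =>
    obtain ⟨h1, p, p', h2, h3, h4, h5⟩ := hx
    exact ⟨hBB' h1, p, p', h2, h3, h4, hle _ h5⟩
  | mismatched q i f =>
    obtain ⟨h1, h2, h3, p, h4, h5⟩ := hx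
    exact ⟨hBB' h1, h2, hle _ h3, p, h4, h.apart_reference_mono h' hle h3 h5⟩

open Classical in
-- Each kind of milestone is indexed by a finite product. Reference states enter only through their
-- output functions, so that classes and not states are counted; a rebuilding sequence needs no
-- index of its own, being determined by `q`, `q'` and `i`.
theorem achieved_bound [Finite QR] (S : PartialMealy QS A O) (R : PartialMealy QR A O)
    (K : ReferenceData R S.alphabet) (obs : List A → Option O) (B : Finset (List A)) :
    {x | Achieved S R K obs B x}.Finite ∧ {x | Achieved S R K obs B x}.ncard ≤
      B.card * S.alphabet.card + 2 * (B.card * (B.card * S.alphabet.card)) +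
        B.card * (R.numClasses Set.univ * R.numClasses Set.univ) +
        B.card * (S.alphabet.card * R.numClasses Set.univ) := by
  have hfin : ((fun q => R.output q) '' Set.univ).Finite := Set.toFinite _
  set F := hfin.toFinset with hF
  have hcard : F.card = R.numClasses Set.univ :=
    (Set.ncard_eq_toFinset_card _ hfin).symm
  have hmem : ∀ p, R.output p ∈ F := fun p => by simp [hF]
  set Z : Finset (Milestone A (List A → Option (List O))) :=
    (B ×ˢ S.alphabet).image (fun x => .extended x.1 x.2) ∪
    (B ×ˢ B ×ˢ S.alphabet).image (fun x => .separated x.1 x.2.1 x.2.2) ∪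
    (B ×ˢ B ×ˢ S.alphabet).image (fun x => .rebuilt x.1 x.2.1 x.2.2) ∪
    (B ×ˢ F ×ˢ F).image (fun x => .refined x.1 x.2.1 x.2.2) ∪
    (B ×ˢ S.alphabet ×ˢ F).image (fun x => .mismatched x.1 x.2.1 x.2.2) with hZ
  have hsub : {x | Achieved S R K obs B x} ⊆ (Z : Set _) := by
    intro x hx
    simp only [hZ, Finset.coe_union, Set.mem_union, Finset.mem_coe, Finset.mem_image,
      Finset.mem_product, Prod.exists]
    cases x with
    | extended q i => exact Or.inl (Or.inl (Or.inl (Or.inl ⟨q, i, ⟨hx.1, hx.2.1⟩, rfl⟩)))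
    | separated q r i =>
      exact Or.inl (Or.inl (Or.inl (Or.inr ⟨q, r, i, ⟨hx.1, hx.2.1, hx.2.2.1⟩, rfl⟩)))
    | rebuilt q q' i =>
      exact Or.inl (Or.inl (Or.inr ⟨q, q', i, ⟨hx.1, hx.2.1, hx.2.2.1⟩, rfl⟩))
    | refined q f f' =>
      obtain ⟨h1, p, p', rfl, rfl, -⟩ := hx
      exact Or.inl (Or.inr ⟨q, _, _, ⟨h1, hmem p, hmem p'⟩, rfl⟩)
    | mismatched q i f =>
      obtain ⟨h1, h2, -, p, rfl, -⟩ := hx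
      exact Or.inr ⟨q, i, _, ⟨h1, h2, hmem p⟩, rfl⟩
  refine ⟨Z.finite_toSet.subset hsub, ?_⟩
  refine (Set.ncard_le_ncard hsub Z.finite_toSet).trans ?_
  rw [Set.ncard_coe_finset, ← hcard]
  have h1 := (Finset.card_image_le (s := B ×ˢ S.alphabet)
    (f := fun x => (.extended x.1 x.2 : Milestone A (List A → Option (List O)))))
  have h2 := (Finset.card_image_le (s := B ×ˢ B ×ˢ S.alphabet)
    (f := fun x => (.separated x.1 x.2.1 x.2.2 : Milestone A (List A → Option (List O)))))
  have h3 := (Finset.card_image_le (s := B ×ˢ B ×ˢ S.alphabet)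
    (f := fun x => (.rebuilt x.1 x.2.1 x.2.2 : Milestone A (List A → Option (List O)))))
  have h4 := (Finset.card_image_le (s := B ×ˢ F ×ˢ F)
    (f := fun x => (.refined x.1 x.2.1 x.2.2 : Milestone A (List A → Option (List O)))))
  have h5 := (Finset.card_image_le (s := B ×ˢ S.alphabet ×ˢ F)
    (f := fun x => (.mismatched x.1 x.2.1 x.2.2 : Milestone A (List A → Option (List O)))))
  simp only [Finset.card_product] at h1 h2 h3 h4 h5
  refine (Finset.card_union_le _ _).trans ?_
  refine (Nat.add_le_add_right (Finset.card_union_le _ _) _).trans ?_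
  refine (Nat.add_le_add_right (Nat.add_le_add_right (Finset.card_union_le _ _) _) _).trans ?_
  refine (Nat.add_le_add_right (Nat.add_le_add_right (Nat.add_le_add_right
    (Finset.card_union_le _ _) _) _) _).trans ?_
  omega

theorem achieved_ncard_mono [Finite QR] (h : Consistent S obs) (h' : Consistent S obs')
    (hle : ∀ w, Seen obs w → Seen obs' w) (hB : ∀ q ∈ B, Seen obs q) (hBB' : B ⊆ B') :
    {x | Achieved S R K obs B x}.ncard ≤ {x | Achieved S R K obs' B' x}.ncard :=
  Set.ncard_le_ncard (fun _ hx => Achieved.mono h h' hle hB hBB' hx)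
    (achieved_bound S R K obs' B').1

theorem achieved_ncard_lt [Finite QR] (h : Consistent S obs) (h' : Consistent S obs')
    (hle : ∀ w, Seen obs w → Seen obs' w) (hB : ∀ q ∈ B, Seen obs q)
    (hnew : ∃ x, Achieved S R K obs' B x ∧ ¬ Achieved S R K obs B x) :
    {x | Achieved S R K obs B x}.ncard < {x | Achieved S R K obs' B x}.ncard := by
  obtain ⟨x, hx, hx'⟩ := hnew
  exact Set.ncard_lt_ncard ⟨fun _ hx => Achieved.mono h h' hle hB subset_rfl hx,
    fun hsub => hx' (hsub hx)⟩ (achieved_bound S R K obs' B).1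

/-! ## The size of the basis -/

/-- Distinct basis states are apart. -/
def PairwiseApart (S : PartialMealy QS A O) (obs : List A → Option O) (B : Finset (List A)) :
    Prop :=
  ∀ q ∈ B, ∀ q' ∈ B, q ≠ q' → Apart (obsTree S.alphabet obs) q (obsTree S.alphabet obs) q'

/-- A witness of apartness in the tree also distinguishes the states that `S` reaches, so basis
states inject into the classes. -/
theorem card_le_numClasses [Finite QS] (h : Consistent S obs) (hB : ∀ q ∈ B, Seen obs q)
    (ha : PairwiseApart S obs B) : B.card ≤ S.numClasses S.reachable := by
  rw [PartialMealy.numClasses, ← Set.ncard_coe_finset]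
  refine Set.ncard_le_ncard_of_injOn (fun w σ => S.outputAfter w σ) ?_ ?_
    ((Set.toFinite S.reachable).image _)
  · intro w hw
    obtain ⟨s, hs⟩ := h.exists_target (hB w hw)
    refine ⟨s, ⟨w, hs⟩, ?_⟩
    funext σ
    simp [PartialMealy.outputAfter, hs]
  · intro w hw w' hw' he
    by_contra hne
    obtain ⟨σ, -, -, hσ⟩ := (h.apart_iff (hB w hw) (hB w' hw')).1 (ha w hw w' hw' hne)
    exact hσ (congrFun he σ)

/-! ### Promotion and adequacy. -/

theorem PromotionAt.seen (h : Consistent S obs) (hB : ∀ q ∈ B, Seen obs q) {r : List A}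
    (hr : PromotionAt (obsTree S.alphabet obs) B r) : r ∉ B ∧ Seen obs r := by
  obtain ⟨h1, q, -, i, -, h2⟩ := (h.mem_frontier_iff hB).1 hr.1
  exact ⟨h1, h2⟩

theorem PairwiseApart.insert [DecidableEq (List A)] {r : List A} (ha : PairwiseApart S obs B)
    (hr : PromotionAt (obsTree S.alphabet obs) B r) : PairwiseApart S obs (insert r B) := by
  intro q hq q' hq' hne
  rcases Finset.mem_insert.1 hq with rfl | hqB <;> rcases Finset.mem_insert.1 hq' with rfl | hqB'
  · exact absurd rfl hne
  · exact hr.2 q' hqB'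
  · exact (hr.2 q hqB).symm
  · exact ha q hqB q' hqB' hne

theorem IsSubtree.insert [DecidableEq (List A)] (h : Consistent S obs) (hB : IsSubtree obs B) {r : List A}
    (hr : PromotionAt (obsTree S.alphabet obs) B r) : IsSubtree obs (insert r B) := by
  obtain ⟨-, q, hq, i, rfl, hseen⟩ := (h.mem_frontier_iff hB.seen).1 hr.1
  refine ⟨Finset.mem_insert_of_mem hB.nil_mem, ?_, ?_⟩
  · intro v a hv
    rcases Finset.mem_insert.1 hv with he | hv
    · obtain ⟨rfl, -⟩ := List.append_inj' he rfl
      exact Finset.mem_insert_of_mem hq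
    · exact Finset.mem_insert_of_mem (hB.init_mem _ _ hv)
  · intro v hv
    rcases Finset.mem_insert.1 hv with rfl | hv
    exacts [hseen, hB.seen v hv]

/-- A pending promotion survives all queries that leave the basis unchanged. -/
theorem PromotionAt.mono (h : Consistent S obs) (h' : Consistent S obs')
    (hle : ∀ w, Seen obs w → Seen obs' w) (hB : IsSubtree obs B) {r : List A}
    (hr : PromotionAt (obsTree S.alphabet obs) B r) :
    PromotionAt (obsTree S.alphabet obs') B r := by
  have hs := (hr.seen h hB.seen).2
  obtain ⟨h1, q, hq, i, h2, h3⟩ := (h.mem_frontier_iff hB.seen).1 hr.1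
  exact ⟨(h'.mem_frontier_iff (hB.mono hle).seen).2 ⟨h1, q, hq, i, h2, hle _ h3⟩,
    fun q hq => h.apart_mono h' hle hs (hB.seen q hq) (hr.2 q hq)⟩

/-- This forces the basis to grow between two processed conflicts, since each leaves a promotion
pending and each requires an adequate tree. -/
theorem Adequate.not_promotionAt {T : PartialMealy (List A) A O} (hT : Adequate T B)
    (r : List A) : ¬ PromotionAt T B r := by
  intro hr
  obtain ⟨q, hq, hna, -⟩ := hT.2 r hr.1
  exact hna (hr.2 q hq)

/-- A frontier state that is neither isolated nor identified is not apart from two basis states.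
These are apart from each other, which supplies the witness for separation. -/
theorem exists_rule_of_not_adequate
    (ha : PairwiseApart S obs B) (hT : ¬ Adequate (obsTree S.alphabet obs) B) :
    (∃ q i, ExtensionAt (obsTree S.alphabet obs) B q i) ∨
      (∃ r, PromotionAt (obsTree S.alphabet obs) B r) ∨
      ∃ r q q' σ, SeparationAt (obsTree S.alphabet obs) B r q q' σ := by
  by_contra hcon
  push Not at hcon
  obtain ⟨h1, h2, h3⟩ := hcon
  refine hT ⟨?_, ?_⟩
  · intro q hq i hi
    by_contra hn
    exact h1 q i ⟨hq, hi, Option.eq_none_iff_forall_ne_some.2 fun x hx => hn ⟨x, hx⟩⟩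
  · intro r hr
    have hiso : ¬ Isolated (obsTree S.alphabet obs) B r := fun hi => h2 r ⟨hr, hi⟩
    unfold Isolated at hiso
    push Not at hiso
    obtain ⟨q, hq, hna⟩ := hiso
    refine ⟨q, hq, hna, fun q' hq' hne => ?_⟩
    by_contra hna'
    obtain ⟨σ, hσ⟩ := ha q hq q' hq' hne.symm
    exact h3 r q q' σ ⟨hr, hq, hq', hne.symm, hna, hna', hσ⟩

end Milestones

/-! ## Each query achieves a milestone -/

section NewMilestones

variable {QS QR A O : Type*} {S : PartialMealy QS A O} {R : PartialMealy QR A O}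
  {K : ReferenceData R S.alphabet} {obs obs' : List A → Option O} {B : Finset (List A)}

/-- The query of the extension rule is a word of the system, and achieves a milestone. -/
theorem ExtensionAt.exists_new (hS : S.IsComplete) (h : Consistent S obs) (hB : IsSubtree obs B)
    {q : List A} {i : A} (hx : ExtensionAt (obsTree S.alphabet obs) B q i) :
    S.IsWord (q ++ [i]) ∧
      ∃ x, Achieved S R K (outputQuery S obs (q ++ [i])) B x ∧ ¬ Achieved S R K obs B x := by
  obtain ⟨hq, hi, hn⟩ := hx
  have hword : S.IsWord (q ++ [i]) := (h.isWord (hB.seen q hq)).append (.singleton hi)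
  refine ⟨hword, .extended q i, ⟨hq, hi, seen_outputQuery_self hS hword⟩, fun hc => ?_⟩
  obtain ⟨o, ho⟩ := Option.ne_none_iff_exists'.1 (hc.2.2.resolve_left (by simp))
  rw [h.step_eq_some_iff.2 ⟨rfl, ho⟩] at hn
  simp at hn

/-- Serves both separation rules. Since `q` and `q'` differ on `σ`, the answer for `r` differs from
at least one of them. -/
theorem exists_new_of_separates (hS : S.IsComplete) (h : Consistent S obs) (hB : IsSubtree obs B)
    {r q q' σ : List A} (hr : r ∈ Frontier (obsTree S.alphabet obs) B) (hq : q ∈ B) (hq' : q' ∈ B)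
    (hrq : ¬ Apart (obsTree S.alphabet obs) r (obsTree S.alphabet obs) q)
    (hrq' : ¬ Apart (obsTree S.alphabet obs) r (obsTree S.alphabet obs) q')
    (hσ : Separates (obsTree S.alphabet obs) q (obsTree S.alphabet obs) q' σ) :
    S.IsWord (r ++ σ) ∧ Seen obs (q ++ σ) ∧
      ∃ x, Achieved S R K (outputQuery S obs (r ++ σ)) B x ∧ ¬ Achieved S R K obs B x := by
  obtain ⟨-, p, hp, i, rfl, hseen⟩ := (h.mem_frontier_iff hB.seen).1 hr
  obtain ⟨h1, h2, h3⟩ := (h.separates_iff (hB.seen q hq) (hB.seen q' hq')).1 hσ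
  have hword : S.IsWord (p ++ [i] ++ σ) :=
    (h.isWord hseen).append (h.isWord h1).of_append_right
  have h' := h.outputQuery (p ++ [i] ++ σ)
  have hle : ∀ w, Seen obs w → Seen (outputQuery S obs (p ++ [i] ++ σ)) w :=
    fun w hw => seen_outputQuery_of_seen hS hword hw
  have hnew := seen_outputQuery_self (obs := obs) hS hword
  have hi : i ∈ S.alphabet := h.isWord hseen i (by simp)
  have key : ∀ t ∈ B, ¬ Apart (obsTree S.alphabet obs) (p ++ [i]) (obsTree S.alphabet obs) t →
      Seen obs (t ++ σ) → S.outputAfter t σ ≠ S.outputAfter (p ++ [i]) σ →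
      ∃ x, Achieved S R K (outputQuery S obs (p ++ [i] ++ σ)) B x ∧ ¬ Achieved S R K obs B x := by
    intro t ht hna hts hne
    refine ⟨.separated t p i, ⟨ht, hp, hi, hle _ hseen, ?_⟩, fun hc => hna hc.2.2.2.2.symm⟩
    exact (h'.apart_iff (hle _ (hB.seen t ht)) (hle _ hseen)).2 ⟨σ, hle _ hts, hnew, hne⟩
  refine ⟨hword, h1, ?_⟩
  by_cases he : S.outputAfter q σ = S.outputAfter (p ++ [i]) σ
  · exact key q' hq' hrq' h2 fun he' => h3 (he.trans he'.symm)
  · exact key q hq hrq h1 he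

theorem RebuildingAt.exists_new (hS : S.IsComplete) (h : Consistent S obs) (hB : IsSubtree obs B)
    {q q' σ : List A} {i : A} (hx : RebuildingAt K (obsTree S.alphabet obs) B q q' i σ) :
    S.IsWord (q ++ i :: σ) ∧ S.IsWord (q' ++ σ) ∧
      ∃ x, Achieved S R K (outputQuery S (outputQuery S obs (q ++ i :: σ)) (q' ++ σ)) B x ∧
        ¬ Achieved S R K obs B x := by
  obtain ⟨hq, hq', hi, -, -, -, -, -, ⟨p, p', hp, hp', ha, rfl⟩, hnone⟩ := hx
  obtain ⟨-, -, u, v, hu, -, -⟩ := K.sep_spec p p' ha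
  have hσ : S.IsWord (K.sep p p') := PartialMealy.isWord_of_restrict_output hu
  have hw1 : S.IsWord (q ++ i :: K.sep p p') := (h.isWord (hB.seen q hq)).append
    (PartialMealy.IsWord.append (v := [i]) (.singleton hi) hσ)
  have hw2 : S.IsWord (q' ++ K.sep p p') := (h.isWord (hB.seen q' hq')).append hσ
  refine ⟨hw1, hw2, .rebuilt q q' i, ⟨hq, hq', hi, p, p', hp, hp',
    seen_outputQuery_of_seen hS hw2 (seen_outputQuery_self hS hw1),
    seen_outputQuery_self hS hw2⟩, ?_⟩
  rintro ⟨-, -, -, s, s', hs, hs', h1, h2⟩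
  -- The reference states of the milestone are determined by `q ++ [i]` and `q'`, so an earlier
  -- milestone would have had the same separating sequence.
  obtain rfl : p = s := Option.some.inj (hp.symm.trans hs)
  obtain rfl : p' = s' := Option.some.inj (hp'.symm.trans hs')
  rw [h.target_eq_none_iff (hB.seen q hq), h.target_eq_none_iff (hB.seen q' hq')] at hnone
  exact hnone.elim (· h1) (· h2)

theorem ApproxMatchRefinementAt.exists_new (hS : S.IsComplete) (h : Consistent S obs)
    (hB : IsSubtree obs B)
    (hsep : ∀ p₁ p₂ p₁' p₂', R.output p₁ = R.output p₂ → R.output p₁' = R.output p₂' →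
      Apart (R.restrict S.alphabet) p₁ (R.restrict S.alphabet) p₁' → K.sep p₁ p₁' = K.sep p₂ p₂')
    {q : List A} {p p' : QR}
    (hx : ApproxMatchRefinementAt K (obsTree S.alphabet obs) B q p p') :
    S.IsWord (q ++ K.sep p p') ∧
      ∃ x, Achieved S R K (outputQuery S obs (q ++ K.sep p p')) B x ∧
        ¬ Achieved S R K obs B x := by
  obtain ⟨hq, -, -, ha, hnone⟩ := hx
  obtain ⟨-, -, u, v, hu, -, -⟩ := K.sep_spec p p' ha
  have hword : S.IsWord (q ++ K.sep p p') :=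
    (h.isWord (hB.seen q hq)).append (PartialMealy.isWord_of_restrict_output hu)
  refine ⟨hword, .refined q (R.output p) (R.output p'),
    ⟨hq, p, p', rfl, rfl, ha, seen_outputQuery_self hS hword⟩, ?_⟩
  rintro ⟨-, s, s', hs, hs', -, hseen⟩
  -- The milestone may stem from other states of the same classes; by `hsep` these have the same
  -- separating sequence.
  rw [h.target_eq_none_iff (hB.seen q hq), hsep p s p' s' hs.symm hs'.symm ha] at hnone
  exact hnone hseen

/-- As `q'` and `p'` differ on `σ`, the answer differs from that of `q'` (a `separated` milestone)
or from that of `p'` (a `mismatched` one). -/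
theorem ApproxMatchSeparationAt.exists_new (hS : S.IsComplete) (h : Consistent S obs)
    (hB : IsSubtree obs B) {q q' σ : List A} {p : QR} {i : A}
    (hx : ApproxMatchSeparationAt R (obsTree S.alphabet obs) B q q' p i σ) :
    S.IsWord (q ++ i :: σ) ∧ q ∈ B ∧ Seen obs (q' ++ σ) ∧
      ∃ x, Achieved S R K (outputQuery S obs (q ++ i :: σ)) B x ∧ ¬ Achieved S R K obs B x := by
  obtain ⟨hq, hq', r, p', hr, -, hrq', -, hrp', -, -, u, v, hu, hv, huv⟩ := hx
  obtain ⟨rfl, hseen⟩ := (h.target_eq_some_iff (hB.seen q hq)).1 hr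
  obtain ⟨hq'σ, hu⟩ := (h.output_eq_some_iff (hB.seen q' hq')).1 hu
  have hsplit : q ++ i :: σ = q ++ [i] ++ σ := by simp
  rw [hsplit]
  have hword : S.IsWord (q ++ [i] ++ σ) :=
    (h.isWord hseen).append (h.isWord hq'σ).of_append_right
  have h' := h.outputQuery (q ++ [i] ++ σ)
  have hle : ∀ w, Seen obs w → Seen (outputQuery S obs (q ++ [i] ++ σ)) w :=
    fun w hw => seen_outputQuery_of_seen hS hword hw
  have hnew := seen_outputQuery_self (obs := obs) hS hword
  have hi : i ∈ S.alphabet := h.isWord hseen i (by simp)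
  refine ⟨hword, hq, hq'σ, ?_⟩
  obtain ⟨t, ht⟩ := h'.exists_outputAfter hnew
  by_cases he : u = t
  · refine ⟨.mismatched q i (R.output p'), ⟨hq, hi, hle _ hseen, p', rfl, σ, t, v, ?_, hv,
      he ▸ huv⟩, ?_⟩
    · exact (h'.output_eq_some_iff (hle _ hseen)).2 ⟨hnew, ht⟩
    · rintro ⟨-, -, -, s, hs, τ, a, b, ha, hb, hab⟩
      exact hrp' ⟨τ, a, b, ha, hs ▸ hb, hab⟩
  · refine ⟨.separated q' q i, ⟨hq', hq, hi, hle _ hseen, ?_⟩, fun hc => hrq' hc.2.2.2.2.symm⟩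
    refine (h'.apart_iff (hle _ (hB.seen q' hq')) (hle _ hseen)).2 ⟨σ, hle _ hq'σ, hnew, ?_⟩
    rw [hu, ht]
    exact fun hc => he (Option.some.inj hc)

/-- Processing a conflict makes a frontier state isolated. -/
theorem ProcCounterEx.exists_promotionAt (hS : S.IsComplete) {obs₁ : List A → Option O}
    (h : Consistent S obs) (hB : IsSubtree obs B)
    {H : PartialMealy B A O} (hH : IsHypothesis (obsTree S.alphabet obs) B H)
    (h₁ : Consistent S obs₁) (hle₁ : ∀ w, Seen obs w → Seen obs₁ w) {σ : List A} {c N : ℕ}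
    (hN : ∀ q ∈ B, q.length ≤ N) (hσ : ConflictAt S H obs₁ σ)
    (hp : ProcCounterEx S H obs₁ σ obs' c) :
    Consistent S obs' ∧ (∀ w, Seen obs w → Seen obs' w) ∧ c ≤ σ.length.size ∧
      (∀ D, (∀ w, Seen obs₁ w → w.length ≤ D) → ∀ w, Seen obs' w → w.length ≤ D + N * c) ∧
      (∃ r, PromotionAt (obsTree S.alphabet obs') B r) ∧
      ∃ x, Achieved S R K obs' B x ∧ ¬ Achieved S R K obs B x := by
  have hB₁ := hB.mono hle₁
  obtain ⟨h', hle, ⟨r, hr, hrc⟩, hcost, hdepth⟩ := hp.spec hS h hB hH hN h₁ hB₁ hσ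
  have hle' : ∀ w, Seen obs w → Seen obs' w := fun w hw => hle w (hle₁ w hw)
  obtain ⟨ρ, hρ, hρσ⟩ := hB₁.exists_frontier_prefix h₁ hσ.1 (hσ.not_mem_basis h hB hH)
  have hr' := hr
  obtain ⟨hrB, q₀, hq₀, i, rfl, hseen⟩ := (h'.mem_frontier_iff (hB.mono hle').seen).1 hr
  have hi : i ∈ S.alphabet := h'.isWord hseen i (by simp)
  obtain ⟨-, q, hq, ha⟩ := hrc
  obtain ⟨hseen₀, hid⟩ := hH.target_frontier h hB hq₀ hi hrB hq
  refine ⟨h', hle', (hcost ρ hρ hρσ).trans (Nat.size_le_size (Nat.sub_le _ _)), hdepth,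
    ⟨_, hr', fun t ht => ?_⟩, .separated q q₀ i, ⟨q.2, hq₀, hi, hseen, ha⟩,
    fun hc => hid.2.1 hc.2.2.2.2.symm⟩
  -- The final conflict gives apartness from `q`; apartness from the other basis states is the
  -- identification used when `H` was built.
  by_cases hte : t = q
  · exact hte ▸ ha.symm
  · exact h.apart_mono h' hle' hseen₀ (hB.seen t ht) (hid.2.2 t ht hte)

end NewMilestones

/-! ## Invariants of a run -/

section Invariant

variable {QS QR A O : Type*}

/-- A bound on the depth of the observation tree. -/
def Config.depthBound (c : Config A O) (n o : ℕ) : ℕ :=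
  c.maxCex + (n + o + 1) * c.oqs

/-- The number of milestones achieved. -/
noncomputable def Config.milestones (S : PartialMealy QS A O) (R : PartialMealy QR A O)
    (K : ReferenceData R S.alphabet) (c : Config A O) : ℕ :=
  {x | Achieved S R K c.obs c.basis x}.ncard

/-- The position of a status in the order of the phases of the algorithm. -/
def Status.rank : Status A O → ℕ
  | .rebuilding => 0
  | .learning => 1
  | .returned _ _ => 2

/-- A measure of progress, which every step increases. -/
noncomputable def Config.progress (S : PartialMealy QS A O) (R : PartialMealy QR A O)
    (K : ReferenceData R S.alphabet) (c : Config A O) : ℕ :=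
  c.basis.card + c.milestones S R K + c.status.rank

/-- The invariants of a run; `p` in the last one is the number of conflicts processed. -/
structure RunInvariant (S : PartialMealy QS A O) (R : PartialMealy QR A O)
    (K : ReferenceData R S.alphabet) (n o : ℕ) (c : Config A O) : Prop where
  consistent : Consistent S c.obs
  subtree : IsSubtree c.obs c.basis
  apart : PairwiseApart S c.obs c.basis
  depth : ∀ w, Seen c.obs w → w.length ≤ c.depthBound n o
  returned : ∀ B H, c.status = .returned B H → H.Equivalent S
  eqs_returned : (∃ B H, c.status = .returned B H) → c.eqs = c.cexs.length + 1
  eqs_running : (¬ ∃ B H, c.status = .returned B H) → c.eqs = c.cexs.length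
  -- Each conflict is matched with a basis state other than the root, the last one possibly with a
  -- promotion still pending. The factor 2 covers the two queries of rebuilding, the `+ 1` the query
  -- of a counterexample itself.
  queries : ∃ p, c.cexs.length ≤ p ∧ (p + 1 ≤ c.basis.card ∨
    p ≤ c.basis.card ∧ ∃ r, PromotionAt (c.tree S.alphabet) c.basis r) ∧
    c.oqs ≤ 2 * c.milestones S R K + p * ((c.depthBound n o).size + 1)

variable {S : PartialMealy QS A O} {R : PartialMealy QR A O} {K : ReferenceData R S.alphabet}
  {n o : ℕ} {c : Config A O}

theorem RunInvariant.initial : RunInvariant S R K n o (Config.initial A O) where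
  consistent := consistent_none S
  subtree := by
    refine ⟨Finset.mem_singleton_self _, ?_, ?_⟩
    · intro q a h
      simp [Config.initial] at h
    · intro q h
      rw [Finset.mem_singleton.1 h]
      exact seen_nil
  apart := by
    intro q h q' h' hne
    exact absurd ((Finset.mem_singleton.1 h).trans (Finset.mem_singleton.1 h').symm) hne
  depth := by
    rintro w (rfl | h)
    · simp
    · exact absurd rfl h
  returned := by intro B H h; simp [Config.initial] at h
  eqs_returned := by rintro ⟨B, H, h⟩; simp [Config.initial] at h
  eqs_running := fun _ => rfl
  queries := ⟨0, le_rfl, Or.inl (by simp [Config.initial]), by simp [Config.initial]⟩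

namespace RunInvariant

theorem card_le [Finite QS] (hc : RunInvariant S R K n o c) :
    c.basis.card ≤ S.numClasses S.reachable :=
  card_le_numClasses hc.consistent hc.subtree.seen hc.apart

open Classical in
-- The basis together with the isolated state is still pairwise apart, so a pending promotion
-- already occupies one more class.
theorem card_lt [Finite QS] (hc : RunInvariant S R K n o c) {r : List A}
    (hr : PromotionAt (c.tree S.alphabet) c.basis r) :
    c.basis.card + 1 ≤ S.numClasses S.reachable := by
  have h := card_le_numClasses hc.consistent (hc.subtree.insert hc.consistent hr).seen
    (hc.apart.insert hr)
  rwa [Finset.card_insert_of_notMem (hr.seen hc.consistent hc.subtree.seen).1] at h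

theorem length_lt [Finite QS] (hn : n = S.numClasses S.reachable)
    (hc : RunInvariant S R K n o c) {q : List A} (hq : q ∈ c.basis) : q.length < n :=
  hn ▸ (hc.subtree.length_lt_card hq).trans_le hc.card_le

theorem length_frontier_le [Finite QS] (hn : n = S.numClasses S.reachable)
    (hc : RunInvariant S R K n o c) {r : List A}
    (hr : r ∈ Frontier (c.tree S.alphabet) c.basis) : r.length ≤ n := by
  obtain ⟨-, q, hq, i, rfl, -⟩ := (hc.consistent.mem_frontier_iff hc.subtree.seen).1 hr
  have := hc.length_lt hn hq
  simp only [List.length_append, List.length_singleton]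
  omega

theorem apart_mono (hc : RunInvariant S R K n o c) {obs' : List A → Option O}
    (h' : Consistent S obs') (hle : ∀ w, Seen c.obs w → Seen obs' w) :
    PairwiseApart S obs' c.basis := fun q hq q' hq' hne =>
  hc.consistent.apart_mono h' hle (hc.subtree.seen q hq) (hc.subtree.seen q' hq')
    (hc.apart q hq q' hq' hne)

/-- A step that poses one or two output queries and achieves a milestone. -/
theorem query [Finite QR] (hc : RunInvariant S R K n o c) {obs' : List A → Option O} {j : ℕ}
    (hj : j ≤ 2) (h' : Consistent S obs') (hle : ∀ w, Seen c.obs w → Seen obs' w)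
    (hdepth : ∀ w, Seen obs' w → Seen c.obs w ∨
      w.length ≤ c.depthBound n o + (n + o + 1) * j)
    (hnew : ∃ x, Achieved S R K obs' c.basis x ∧ ¬ Achieved S R K c.obs c.basis x) :
    RunInvariant S R K n o { c with obs := obs', oqs := c.oqs + j } ∧
      c.progress S R K < Config.progress S R K { c with obs := obs', oqs := c.oqs + j } := by
  have hlt := achieved_ncard_lt hc.consistent h' hle hc.subtree.seen hnew
  have hD : Config.depthBound { c with obs := obs', oqs := c.oqs + j } n o =
      c.depthBound n o + (n + o + 1) * j := by
    simp only [Config.depthBound, Config.maxCex]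
    ring
  refine ⟨⟨h', hc.subtree.mono hle, hc.apart_mono h' hle, ?_, hc.returned, hc.eqs_returned,
    hc.eqs_running, ?_⟩, ?_⟩
  · intro w hw
    rw [hD]
    exact (hdepth w hw).elim (fun hs => (hc.depth w hs).trans (Nat.le_add_right _ _)) id
  · obtain ⟨p, h1, h2, h3⟩ := hc.queries
    refine ⟨p, h1, h2.imp_right fun h => ⟨h.1, ?_⟩, ?_⟩
    · obtain ⟨r, hr⟩ := h.2
      exact ⟨r, hr.mono hc.consistent h' hle hc.subtree⟩
    · have h4 : p * ((c.depthBound n o).size + 1) ≤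
          p * ((Config.depthBound { c with obs := obs', oqs := c.oqs + j } n o).size + 1) := by
        refine Nat.mul_le_mul_left _ (Nat.add_le_add_right (Nat.size_le_size ?_) _)
        rw [hD]
        exact Nat.le_add_right _ _
      simp only [Config.milestones] at h3 ⊢
      omega
  · simp only [Config.progress, Config.milestones]
    omega

/-- A step that poses a single output query and achieves a milestone. -/
theorem query_one [Finite QR] (hS : S.IsComplete) (hc : RunInvariant S R K n o c) {w : List A}
    (hw : S.IsWord w) (hlen : w.length ≤ c.depthBound n o + (n + o + 1))
    (hnew : ∃ x, Achieved S R K (outputQuery S c.obs w) c.basis x ∧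
      ¬ Achieved S R K c.obs c.basis x) :
    RunInvariant S R K n o { c with obs := outputQuery S c.obs w, oqs := c.oqs + 1 } ∧
      c.progress S R K <
        Config.progress S R K { c with obs := outputQuery S c.obs w, oqs := c.oqs + 1 } :=
  hc.query (by omega) (hc.consistent.outputQuery w)
    (fun _ hv => seen_outputQuery_of_seen hS hw hv)
    (fun _ hv => ((seen_outputQuery_iff hS hw).1 hv).imp_right fun hp => by
      have := hp.length_le
      omega) hnew

theorem promote [Finite QR] [DecidableEq (List A)] (hc : RunInvariant S R K n o c) {r : List A}
    (hr : PromotionAt (c.tree S.alphabet) c.basis r) :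
    RunInvariant S R K n o { c with basis := insert r c.basis } ∧
      c.progress S R K < Config.progress S R K { c with basis := insert r c.basis } := by
  have hle := achieved_ncard_mono (R := R) (K := K) hc.consistent hc.consistent
    (fun _ hw => hw) hc.subtree.seen (Finset.subset_insert r c.basis)
  have hcard : (insert r c.basis).card = c.basis.card + 1 :=
    Finset.card_insert_of_notMem (hr.seen hc.consistent hc.subtree.seen).1
  refine ⟨⟨hc.consistent, hc.subtree.insert hc.consistent hr, hc.apart.insert hr, hc.depth,
    hc.returned, hc.eqs_returned, hc.eqs_running, ?_⟩, ?_⟩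
  · obtain ⟨p, h1, h2, h3⟩ := hc.queries
    refine ⟨p, h1, Or.inl ?_, h3.trans (Nat.add_le_add_right (Nat.mul_le_mul_left 2 hle) _)⟩
    show p + 1 ≤ (insert r c.basis).card
    rcases h2 with h2 | h2 <;> omega
  · simp only [Config.progress, Config.milestones]
    omega

/-- A step that processes a conflict, after `e ≤ 1` further queries, those of the
counterexamples in the list `l` prepended. -/
theorem process [Finite QS] [Finite QR] (hS : S.IsComplete) (hn : n = S.numClasses S.reachable)
    (hc : RunInvariant S R K n o c)
    (hs : c.status = .learning) (hT : Adequate (c.tree S.alphabet) c.basis)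
    {H : PartialMealy c.basis A O} (hH : IsHypothesis (c.tree S.alphabet) c.basis H)
    {obs₁ obs' : List A → Option O} {σ : List A} {cost : ℕ} {l : List (List A)}
    (hl : l.length ≤ 1) (h₁ : Consistent S obs₁) (hle₁ : ∀ w, Seen c.obs w → Seen obs₁ w)
    (hseen₁ : ∀ w, Seen obs₁ w → Seen c.obs w ∨ ∃ ρ ∈ l, w <+: ρ)
    (hσ : ConflictAt S H obs₁ σ) (hp : ProcCounterEx S H obs₁ σ obs' cost) :
    RunInvariant S R K n o { c with
      obs := obs'
      oqs := c.oqs + l.length + cost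
      eqs := c.eqs + l.length
      cexs := l ++ c.cexs } ∧
    c.progress S R K < Config.progress S R K { c with
      obs := obs'
      oqs := c.oqs + l.length + cost
      eqs := c.eqs + l.length
      cexs := l ++ c.cexs } := by
  obtain ⟨h', hle, hcost, hdepth, hprom, hnew⟩ := hp.exists_promotionAt (R := R) (K := K) hS
    hc.consistent hc.subtree hH h₁ hle₁ (fun q hq => (hc.length_lt hn hq).le) hσ
  have hlt := achieved_ncard_lt hc.consistent h' hle hc.subtree.seen hnew
  set m := (l.map List.length).foldr max c.maxCex with hm
  have hmax : Config.maxCex { c with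
      obs := obs'
      oqs := c.oqs + l.length + cost
      eqs := c.eqs + l.length
      cexs := l ++ c.cexs } = m := by
    simp [Config.maxCex, hm, List.foldr_append]
  have hml : ∀ ρ ∈ l, ρ.length ≤ m := by
    rw [hm]
    clear * -
    induction l with
    | nil => simp
    | cons a l ih =>
      intro ρ hρ
      rcases List.mem_cons.1 hρ with rfl | hρ
      · exact le_max_left _ _
      · exact (ih ρ hρ).trans (le_max_right _ _)
  have hmc : c.maxCex ≤ m := by
    rw [hm]
    clear * -
    induction l with
    | nil => exact le_rfl
    | cons a l ih => exact ih.trans (le_max_right _ _)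
  have hD₁ : ∀ w, Seen obs₁ w → w.length ≤ m + (n + o + 1) * c.oqs := by
    intro w hw
    rcases hseen₁ w hw with hw | ⟨ρ, hρ, hw⟩
    · exact (hc.depth w hw).trans (Nat.add_le_add_right hmc _)
    · exact (hw.length_le.trans (hml ρ hρ)).trans (Nat.le_add_right _ _)
  have hD₂ : m + (n + o + 1) * c.oqs + n * cost ≤
      m + (n + o + 1) * (c.oqs + l.length + cost) := by nlinarith
  have hD₃ : c.depthBound n o ≤ m + (n + o + 1) * (c.oqs + l.length + cost) := by
    simp only [Config.depthBound]
    nlinarith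
  have hrun : ¬ ∃ B H, c.status = .returned B H := by
    rintro ⟨B, H, h⟩
    rw [hs] at h
    simp at h
  refine ⟨⟨h', hc.subtree.mono hle, hc.apart_mono h' hle, ?_, hc.returned,
    fun h => absurd h hrun, fun _ => ?_, ?_⟩, ?_⟩
  · intro w hw
    rw [Config.depthBound, hmax]
    exact (hdepth _ hD₁ w hw).trans hD₂
  · have := hc.eqs_running hrun
    simp only [List.length_append]
    omega
  · obtain ⟨p, h1, h2, h3⟩ := hc.queries
    -- The tree is adequate, so no promotion is pending from an earlier conflict.
    have hp1 : p + 1 ≤ c.basis.card :=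
      h2.resolve_right fun h => hT.not_promotionAt h.2.choose h.2.choose_spec
    refine ⟨p + 1, ?_, Or.inr ⟨hp1, hprom⟩, ?_⟩
    · simp only [List.length_append]
      omega
    · rw [Config.depthBound, hmax]
      have h4 := Nat.size_le_size hD₃
      -- The conflict is itself an observed sequence, so the depth bound controls its length.
      have h5 := hcost.trans (Nat.size_le_size
        ((hD₁ σ hσ.1).trans ((Nat.le_add_right _ _).trans hD₂)))
      simp only [Config.milestones] at h3 ⊢
      generalize (m + (n + o + 1) * (c.oqs + l.length + cost)).size = s at h4 h5 ⊢
      have h6 : p * ((c.depthBound n o).size + 1) ≤ p * (s + 1) :=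
        Nat.mul_le_mul_left _ (by omega)
      rw [Nat.add_mul, Nat.one_mul]
      omega
  · simp only [Config.progress, Config.milestones]
    omega

end RunInvariant

end Invariant

/-! ### Preservation of the invariants, and absence of deadlock. -/

section Steps

variable {QS QR A O : Type*} {S : PartialMealy QS A O} {R : PartialMealy QR A O}
  {K : ReferenceData R S.alphabet} {n o : ℕ} {c c' : Config A O}

open Classical in
/-- Every step preserves the invariants and makes progress. -/
theorem RunInvariant.step [Finite QS] [Finite QR] (hS : S.IsComplete)
    (hsep : ∀ p₁ p₂ p₁' p₂', R.output p₁ = R.output p₂ → R.output p₁' = R.output p₂' →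
      Apart (R.restrict S.alphabet) p₁ (R.restrict S.alphabet) p₁' → K.sep p₁ p₁' = K.sep p₂ p₂')
    (hlen : ∀ p p', Apart (R.restrict S.alphabet) p (R.restrict S.alphabet) p' →
      (K.sep p p').length ≤ o)
    (hn : n = S.numClasses S.reachable) (hc : RunInvariant S R K n o c)
    (h : ALSharpStep S R K c c') :
    RunInvariant S R K n o c' ∧ c.progress S R K < c'.progress S R K := by
  have hrun : c.status = .rebuilding ∨ c.status = .learning →
      ¬ ∃ B H, c.status = .returned B H := by
    rintro (h | h) ⟨B, H, h'⟩ <;> rw [h] at h' <;> simp at h'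
  cases h with
  | rebuilding q q' i σ hs hx =>
    obtain ⟨hw1, hw2, hnew⟩ := hx.exists_new hS hc.consistent hc.subtree
    have hσ : σ.length ≤ o := by
      obtain ⟨p, p', -, -, ha, rfl⟩ := hx.2.2.2.2.2.2.2.2.1
      exact hlen p p' ha
    have h1 := hc.length_lt hn hx.1
    have h2 := hc.length_lt hn hx.2.1
    refine hc.query le_rfl ((hc.consistent.outputQuery _).outputQuery _)
      (fun _ hv => seen_outputQuery_of_seen hS hw2 (seen_outputQuery_of_seen hS hw1 hv)) ?_ hnew
    intro v hv
    rw [seen_outputQuery_iff hS hw2, seen_outputQuery_iff hS hw1] at hv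
    rcases hv with (hv | hv) | hv
    · exact Or.inl hv
    · have := hv.length_le
      simp only [List.length_append, List.length_cons] at this
      omega
    · have := hv.length_le
      simp only [List.length_append] at this
      omega
  | prioritizedPromotion r hs hx => exact hc.promote ⟨hx.1, hx.2.2⟩
  | endRebuilding hs =>
    have hr := hrun (Or.inl hs)
    refine ⟨⟨hc.consistent, hc.subtree, hc.apart, hc.depth, fun B H h => by simp at h,
      fun ⟨B, H, h⟩ => by simp at h, fun _ => hc.eqs_running hr, hc.queries⟩, ?_⟩
    simp only [Config.progress, hs, Status.rank]
    exact Nat.lt_succ_self _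
  | extension q i hs hx =>
    obtain ⟨hw, hnew⟩ := hx.exists_new hS hc.consistent hc.subtree
    have := hc.length_lt hn hx.1
    refine hc.query_one hS hw ?_ hnew
    simp only [List.length_append, List.length_singleton]
    omega
  | approxPrioritizedSeparation r q' q'' σ hs hx =>
    obtain ⟨hw, hqσ, hnew⟩ := exists_new_of_separates (K := K) hS hc.consistent hc.subtree hx.1
      hx.2.1 hx.2.2.1 hx.2.2.2.1 hx.2.2.2.2.1 hx.2.2.2.2.2.1
    have h1 := hc.length_frontier_le hn hx.1
    have h2 := hc.depth _ hqσ
    refine hc.query_one hS hw ?_ hnew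
    simp only [List.length_append] at h2 ⊢
    omega
  | separation r q q' σ hs hx =>
    obtain ⟨hw, hqσ, hnew⟩ := exists_new_of_separates (K := K) hS hc.consistent hc.subtree hx.1
      hx.2.1 hx.2.2.1 hx.2.2.2.2.1 hx.2.2.2.2.2.1 hx.2.2.2.2.2.2
    have h1 := hc.length_frontier_le hn hx.1
    have h2 := hc.depth _ hqσ
    refine hc.query_one hS hw ?_ hnew
    simp only [List.length_append] at h2 ⊢
    omega
  | promotion r hs hx => exact hc.promote hx
  | approxMatchRefinement q p p' hs hT hx =>
    obtain ⟨hw, hnew⟩ := hx.exists_new hS hc.consistent hc.subtree hsep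
    have h1 := hc.length_lt hn hx.1
    have h2 := hlen p p' hx.2.2.2.1
    refine hc.query_one hS hw ?_ hnew
    simp only [List.length_append]
    omega
  | approxMatchSeparation q q' p i σ hs hT hnr hx =>
    obtain ⟨hw, hq, hqσ, hnew⟩ := hx.exists_new (K := K) hS hc.consistent hc.subtree
    have h1 := hc.length_lt hn hq
    have h2 := hc.depth _ hqσ
    refine hc.query_one hS hw ?_ hnew
    simp only [List.length_append, List.length_cons] at h2 ⊢
    omega
  | inconsistent H σ obs' cost hs hT hnr hns hH hconf hp =>
    exact hc.process hS hn hs hT hH (l := []) (by simp) hc.consistent (fun _ hv => hv)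
      (fun _ hv => Or.inl hv) (hc.consistent.conflict_iff.1 hconf) hp
  | counterexample H ρ σ obs' cost hs hT hnr hns hH hnc hρ hne hσρ hconf hmin hp =>
    have h₁ := hc.consistent.outputQuery ρ
    exact hc.process hS hn hs hT hH (l := [ρ]) le_rfl h₁
      (fun _ hv => seen_outputQuery_of_seen hS hρ hv)
      (fun _ hv => ((seen_outputQuery_iff hS hρ).1 hv).imp_right fun h =>
        ⟨ρ, List.mem_singleton_self ρ, h⟩) (h₁.conflict_iff.1 hconf) hp
  | accept H hs hT hnr hns hH hnc heq =>
    have hr := hrun (Or.inr hs)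
    refine ⟨⟨hc.consistent, hc.subtree, hc.apart, hc.depth, ?_, fun _ => ?_, fun h => ?_,
      hc.queries⟩, ?_⟩
    · intro B H' h
      obtain ⟨rfl, h⟩ := Status.returned.inj h
      obtain rfl := eq_of_heq h
      refine ⟨hH.1, fun w hw => ?_⟩
      have hw' : S.IsWord w := fun a ha => hH.1 ▸ hw a ha
      obtain ⟨u, hu⟩ := hS.exists_output S.init hw'
      exact ⟨u, (heq w hw').trans hu, hu⟩
    · exact congrArg (· + 1) (hc.eqs_running hr)
    · exact absurd ⟨_, _, rfl⟩ h
    · simp only [Config.progress, hs, Status.rank]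
      exact Nat.lt_succ_self _

/-- A conflict of the tree in which `obs₁` has been observed can be processed. -/
theorem RunInvariant.exists_process (hS : S.IsComplete) (hc : RunInvariant S R K n o c)
    {H : PartialMealy c.basis A O} (hH : IsHypothesis (c.tree S.alphabet) c.basis H)
    {obs₁ : List A → Option O} {σ : List A} (h₁ : Consistent S obs₁)
    (hle₁ : ∀ w, Seen c.obs w → Seen obs₁ w) (hσ : Conflict (obsTree S.alphabet obs₁) H σ) :
    ∃ obs' cost, ProcCounterEx S H obs₁ σ obs' cost :=
  ConflictAt.exists_procCounterEx hS hc.consistent hc.subtree hH σ.length h₁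
    (hc.subtree.mono hle₁) (h₁.conflict_iff.1 hσ) fun _ _ _ => Nat.sub_le _ _

/-- If the tree is adequate and neither matching rule applies, a hypothesis exists. A conflict in
the tree can be processed, a correct hypothesis is accepted, and a wrong one yields a conflict once
the counterexample has been queried. -/
theorem RunInvariant.exists_step (hS : S.IsComplete) (hc : RunInvariant S R K n o c)
    (hr : ¬ ∃ B H, c.status = .returned B H) : ∃ c', ALSharpStep S R K c c' := by
  rcases hs : c.status with _ | _ | ⟨B, H⟩
  · by_cases h1 : ∃ q q' i σ, RebuildingAt K (c.tree S.alphabet) c.basis q q' i σ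
    · obtain ⟨q, q', i, σ, h1⟩ := h1
      exact ⟨_, .rebuilding c q q' i σ hs h1⟩
    by_cases h2 : ∃ r, PrioritizedPromotionAt K (c.tree S.alphabet) c.basis r
    · obtain ⟨r, h2⟩ := h2
      exact ⟨_, .prioritizedPromotion c r hs h2⟩
    exact ⟨_, .endRebuilding c hs h1 h2⟩
  · by_cases hT : Adequate (c.tree S.alphabet) c.basis
    · by_cases h1 : ∃ q p p', ApproxMatchRefinementAt K (c.tree S.alphabet) c.basis q p p'
      · obtain ⟨q, p, p', h1⟩ := h1
        exact ⟨_, .approxMatchRefinement c q p p' hs hT h1⟩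
      by_cases h2 : ∃ q q' p i σ,
          ApproxMatchSeparationAt R (c.tree S.alphabet) c.basis q q' p i σ
      · obtain ⟨q, q', p, i, σ, h2⟩ := h2
        exact ⟨_, .approxMatchSeparation c q q' p i σ hs hT h1 h2⟩
      obtain ⟨H, hH⟩ := hT.exists_isHypothesis hc.consistent hc.subtree
      by_cases h3 : ∃ τ, Conflict (c.tree S.alphabet) H τ
      · obtain ⟨σ, h3⟩ := h3
        obtain ⟨obs', cost, hp⟩ := hc.exists_process hS hH hc.consistent (fun _ hv => hv) h3
        exact ⟨_, .inconsistent c H σ obs' cost hs hT h1 h2 hH h3 hp⟩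
      by_cases h4 : ∀ ρ, S.IsWord ρ → H.output H.init ρ = S.output S.init ρ
      · exact ⟨_, .accept c H hs hT h1 h2 hH h3 h4⟩
      push Not at h4
      obtain ⟨ρ, hρ, hne⟩ := h4
      have h₁ := hc.consistent.outputQuery ρ
      have hle₁ : ∀ w, Seen c.obs w → Seen (outputQuery S c.obs ρ) w :=
        fun _ hv => seen_outputQuery_of_seen hS hρ hv
      obtain ⟨σ, ⟨hσρ, hσ⟩, hmin⟩ := WellFounded.has_min
        (InvImage.wf List.length Nat.lt_wfRel.wf)
        {τ | τ <+: ρ ∧ Conflict (obsTree S.alphabet (outputQuery S c.obs ρ)) H τ}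
        (hH.exists_conflict hc.consistent hc.subtree h₁ hle₁
          (seen_outputQuery_self hS hρ) hne)
      obtain ⟨obs', cost, hp⟩ := hc.exists_process hS hH h₁ hle₁ hσ
      exact ⟨_, .counterexample c H ρ σ obs' cost hs hT h1 h2 hH h3 hρ hne hσρ hσ
        (fun τ hτρ hτ => not_lt.1 fun hlt => hmin τ ⟨hτρ, hτ⟩ hlt) hp⟩
    · rcases exists_rule_of_not_adequate hc.apart hT with ⟨q, i, h⟩ | ⟨r, h⟩ | ⟨r, q, q', σ, h⟩
      · exact ⟨_, .extension c q i hs h⟩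
      · exact ⟨_, .promotion c r hs h⟩
      · exact ⟨_, .separation c r q q' σ hs h⟩
  · exact absurd ⟨B, H, hs⟩ hr

theorem ALSharpStep.not_returned (h : ALSharpStep S R K c c') :
    ¬ ∃ B H, c.status = .returned B H := by
  rintro ⟨B, H, hr⟩
  cases h <;> simp_all

theorem RunInvariant.milestones_le [Finite QS] [Finite QR] (hn : n = S.numClasses S.reachable)
    (ho : o = R.numClasses Set.univ) (hc : RunInvariant S R K n o c) :
    c.milestones S R K ≤ n * S.alphabet.card + 2 * (n * (n * S.alphabet.card)) + n * (o * o) +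
      n * (S.alphabet.card * o) := by
  have hcard := hn ▸ hc.card_le
  refine (achieved_bound S R K c.obs c.basis).2.trans ?_
  rw [← ho]
  gcongr

end Steps

/-! ## The bound on the number of output queries -/

/-- A number of binary size `s + 1` is at least `2 ^ s`, and `3 / 2` exceeds `1 / log 2`. -/
theorem size_le_log {D : ℕ} {y : ℝ} (hD : (D : ℝ) ≤ y) (hy : 1 ≤ y) :
    (D.size : ℝ) ≤ 1 + 3 / 2 * Real.log y := by
  have hlog := Real.log_nonneg hy
  rcases h : D.size with _ | s
  · push_cast
    linarith
  · have h1 : 2 ^ s ≤ D := Nat.lt_size.1 (by omega)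
    have h2 : (2 : ℝ) ^ s ≤ y := le_trans (by exact_mod_cast h1) hD
    have h3 := Real.log_le_log (by positivity) h2
    rw [Real.log_pow] at h3
    have h4 := Real.log_two_gt_d9
    have h5 : (0 : ℝ) ≤ s := Nat.cast_nonneg s
    push_cast
    nlinarith

/-- A number of queries bounded by a polynomial and by logarithms of itself. -/
theorem queries_le_of_self_bound {N M p n o k m : ℕ} (hk : k = 0 → n = 1) (ho : 1 ≤ o)
    (hp : p + 1 ≤ n) (hM : M ≤ n * k + 2 * (n * (n * k)) + n * (o * o) + n * (k * o))
    (hN : N ≤ 2 * M + p * ((m + (n + o + 1) * N).size + 1)) :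
    (N : ℝ) ≤ 30 * (k * n ^ 2 + k * n * o + n * o ^ 2 + n * Real.log m) := by
  have hlogm : 0 ≤ Real.log m := Real.log_natCast_nonneg m
  -- Without inputs the terms containing `k` vanish and cannot absorb lower-order terms. But then `n
  -- = 1`, no conflict is processed, and `n * o ^ 2` suffices.
  rcases Nat.eq_zero_or_pos k with rfl | hk0
  · obtain rfl := hk rfl
    obtain rfl : p = 0 := by omega
    have h1 : (N : ℝ) ≤ 2 * (o * o) := by
      have : N ≤ 2 * (o * o) := by
        simp only [Nat.mul_zero, Nat.zero_mul, Nat.one_mul, Nat.zero_add, Nat.add_zero] at hM hN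
        omega
      exact_mod_cast this
    push_cast
    nlinarith [sq_nonneg (o : ℝ)]
  have hn1 : (1 : ℝ) ≤ n := by exact_mod_cast (show 1 ≤ n by omega)
  have ho1 : (1 : ℝ) ≤ o := by exact_mod_cast ho
  have hk1 : (1 : ℝ) ≤ k := by exact_mod_cast hk0
  have hN0 : (0 : ℝ) ≤ N := Nat.cast_nonneg N
  set x : ℝ := n + o + 1 with hx
  have hx3 : 3 ≤ x := by linarith
  -- Without a counterexample `m = 0`, and `Real.log 0 = 0 = Real.log 1`.
  have hlogmax : Real.log (max (m : ℝ) 1) = Real.log m := by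
    rcases Nat.eq_zero_or_pos m with rfl | hm
    · simp
    · rw [max_eq_left (by exact_mod_cast hm)]
  have hz : 1 ≤ 1 + x * N := by nlinarith
  have hD : ((m + (n + o + 1) * N : ℕ) : ℝ) ≤ max (m : ℝ) 1 * (1 + x * N) := by
    push_cast
    have h1 := le_max_left (m : ℝ) 1
    have h2 := le_max_right (m : ℝ) 1
    nlinarith [mul_nonneg (by linarith : 0 ≤ x) hN0]
  have hy : 1 ≤ max (m : ℝ) 1 * (1 + x * N) := one_le_mul_of_one_le_of_one_le (le_max_right _ _) hz
  have hsize := size_le_log hD hy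
  rw [Real.log_mul (by positivity) (by positivity), hlogmax] at hsize
  -- This is `log t ≤ t - 1` for `t = (1 + x * N) / (4 * n * x)`, and again for the factors 4, `n`
  -- and `x`. The divisor makes the total contribution of `N`, after multiplication by `n` and `3 /
  -- 2`, at most `3 / 8 * N`, which the left side absorbs.
  have hlogz : Real.log (1 + x * N) ≤ (1 + x * N) / (4 * n * x) + (1 + n + x) := by
    have ha : 0 < 4 * n * x := by positivity
    have h1 := Real.log_le_sub_one_of_pos (show 0 < (1 + x * N) / (4 * n * x) by positivity)
    rw [Real.log_div (by positivity) ha.ne', Real.log_mul (by positivity) (by positivity),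
      Real.log_mul (by norm_num) (by positivity)] at h1
    have h2 := Real.log_le_sub_one_of_pos (show (0 : ℝ) < 4 by norm_num)
    have h3 := Real.log_le_sub_one_of_pos (show (0 : ℝ) < n by positivity)
    have h4 := Real.log_le_sub_one_of_pos (show 0 < x by positivity)
    linarith
  have hquot : n * ((1 + x * N) / (4 * n * x)) ≤ (1 + N) / 4 := by
    have : n * ((1 + x * N) / (4 * n * x)) = (1 / x + N) / 4 := by field_simp
    rw [this]
    have : 1 / x ≤ 1 := by rw [div_le_one (by positivity)]; linarith
    linarith
  have hNr : (N : ℝ) ≤ 2 * M + p * (((m + (n + o + 1) * N).size : ℕ) + 1) := by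
    exact_mod_cast hN
  have hMr : (M : ℝ) ≤ n * k + 2 * (n * (n * k)) + n * (o * o) + n * (k * o) := by
    exact_mod_cast hM
  have hpr : (p : ℝ) ≤ n := by exact_mod_cast (show p ≤ n by omega)
  have hmain : p * (((m + (n + o + 1) * N).size : ℝ) + 1) ≤
      n * (2 + 3 / 2 * Real.log m + 3 / 2 * (1 + n + x)) + 3 / 2 * ((1 + N) / 4) := by
    calc p * (((m + (n + o + 1) * N).size : ℝ) + 1)
        ≤ n * (((m + (n + o + 1) * N).size : ℝ) + 1) := by gcongr
      _ ≤ n * (2 + 3 / 2 * (Real.log m + ((1 + x * N) / (4 * n * x) + (1 + n + x)))) :=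
          mul_le_mul_of_nonneg_left (by linarith) (by linarith)
      _ ≤ _ := by linarith
  have e1 : (n : ℝ) ≤ n * n := le_mul_of_one_le_left (by linarith) hn1
  have hk' : (0 : ℝ) ≤ k - 1 := by linarith
  have e2 : (n * n : ℝ) ≤ k * n ^ 2 := by nlinarith [mul_nonneg hk' (sq_nonneg (n : ℝ))]
  have hno : (0 : ℝ) ≤ n * o := by positivity
  have e3 : (n * o : ℝ) ≤ k * n * o := by nlinarith [mul_nonneg hk' hno]
  have e4 : (n * k : ℝ) ≤ k * n ^ 2 := by
    have := mul_le_mul_of_nonneg_left e1 (by linarith : (0 : ℝ) ≤ k)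
    linarith
  have e5 : (0 : ℝ) ≤ n * o ^ 2 := by positivity
  have e6 : (0 : ℝ) ≤ n * Real.log m := by positivity
  have e7 : (0 : ℝ) ≤ k * n * o := by positivity
  rw [hx] at hmain
  have hmain' := hNr.trans (add_le_add_right hmain (2 * (M : ℝ)))
  clear_value x
  clear hsize hlogz hquot hD hy hmain hN hM hz hNr
  linarith

/-! ### Degenerate values of the parameters. -/

section Numbers

variable {Q A O : Type*}

theorem PartialMealy.numClasses_pos [Finite Q] (M : PartialMealy Q A O) {X : Set Q}
    (hX : X.Nonempty) : 1 ≤ M.numClasses X :=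
  (Set.ncard_pos (Set.toFinite X |>.image _)).2 (hX.image _)

theorem PartialMealy.numClasses_reachable_of_card_alphabet_eq_zero (M : PartialMealy Q A O)
    (h : M.alphabet.card = 0) : M.numClasses M.reachable = 1 := by
  have hr : M.reachable = {M.init} := by
    ext q
    constructor
    · rintro ⟨w, hw⟩
      obtain ⟨u, hu⟩ := target_isSome_iff.1 ⟨q, hw⟩
      rcases w with _ | ⟨a, w⟩
      · exact (Option.some.inj hw).symm
      · have := isWord_of_output hu a (by simp)
        rw [Finset.card_eq_zero.1 h] at this
        simp at this
    · rintro rfl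
      exact ⟨[], rfl⟩
  rw [numClasses, hr, Set.image_singleton, Set.ncard_singleton]

end Numbers

/-! ### Assembly of the main theorem. -/

theorem mainTheorem1 :
    ∃ C : ℝ, ∀ {A O QS QR : Type*} [Finite QS] [Finite QR]
      (S : PartialMealy QS A O) (R : PartialMealy QR A O),
      S.IsComplete → R.IsComplete →
      ∀ K : ReferenceData R S.alphabet,
      -- separating sequences depend only on the language equivalence classes of the states
      (∀ p₁ p₂ p₁' p₂', R.output p₁ = R.output p₂ → R.output p₁' = R.output p₂' →
        Apart (R.restrict S.alphabet) p₁ (R.restrict S.alphabet) p₁' →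
        K.sep p₁ p₁' = K.sep p₂ p₂') →
      -- and are not longer than the number of these classes
      (∀ p p', Apart (R.restrict S.alphabet) p (R.restrict S.alphabet) p' →
        (K.sep p p').length ≤ R.numClasses Set.univ) →
      ∀ n o k : ℕ, n = S.numClasses S.reachable → o = R.numClasses Set.univ →
      k = S.alphabet.card →
      -- every run is finite
      (¬ ∃ run : ℕ → Config A O, run 0 = Config.initial A O ∧
        ∀ j, ALSharpStep S R K (run j) (run (j + 1))) ∧
      ∀ c : Config A O, ALSharpReaches S R K c →
        -- a run can only end by returning a hypothesis, and this is correct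
        ((¬ ∃ c', ALSharpStep S R K c c') ↔ ∃ B H, c.status = .returned B H) ∧
        (∀ B H, c.status = .returned B H → H.Equivalent S) ∧
        -- the number of output queries
        (c.oqs : ℝ) ≤ C * (k * n ^ 2 + k * n * o + n * o ^ 2 + n * Real.log c.maxCex) ∧
        -- all equivalence queries but the last, accepted one give a counterexample
        ((∃ B H, c.status = .returned B H) → c.eqs = c.cexs.length + 1) ∧
        ((¬ ∃ B H, c.status = .returned B H) → c.eqs = c.cexs.length) ∧
        c.cexs.length + 1 ≤ n := by
  refine ⟨30, ?_⟩
  intro A O QS QR _ _ S R hS hR K hsep hlen n o k hn ho hk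
  have hreach : ∀ c, ALSharpReaches S R K c → RunInvariant S R K n o c := by
    intro c hc
    induction hc with
    | refl => exact RunInvariant.initial
    | tail _ hstep ih => exact (ih.step hS hsep (ho ▸ hlen) hn hstep).1
  refine ⟨?_, fun c hc => ?_⟩
  · rintro ⟨run, h0, hrun⟩
    have hr : ∀ j, ALSharpReaches S R K (run j) := by
      intro j
      induction j with
      | zero => rw [h0]; exact Relation.ReflTransGen.refl
      | succ j ih => exact ih.tail (hrun j)
    have hprog : ∀ j, j ≤ (run j).progress S R K := by
      intro j
      induction j with
      | zero => exact Nat.zero_le _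
      | succ j ih => exact ih.trans_lt ((hreach _ (hr j)).step hS hsep (ho ▸ hlen) hn (hrun j)).2
    -- The summands bound the basis size, the number of milestones and the rank of the status.
    have hbound : ∀ j, (run j).progress S R K ≤ n + (n * S.alphabet.card +
        2 * (n * (n * S.alphabet.card)) + n * (o * o) + n * (S.alphabet.card * o)) + 2 := by
      intro j
      refine Nat.add_le_add (Nat.add_le_add (hn ▸ (hreach _ (hr j)).card_le)
        ((hreach _ (hr j)).milestones_le hn ho)) ?_
      cases (run j).status <;> simp [Status.rank]
    -- Progress is at least the step index; the contradiction is at the index one above the bound.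
    exact absurd ((hprog _).trans (hbound _)) (Nat.not_succ_le_self _)
  have hinv := hreach c hc
  obtain ⟨p, hp1, hp2, hp3⟩ := hinv.queries
  -- If only `p ≤ c.basis.card` is known, the pending promotion supplies the missing one.
  have hpn : p + 1 ≤ n := by
    rw [hn]
    rcases hp2 with hp2 | ⟨hp2, r, hr⟩
    · exact hp2.trans hinv.card_le
    · exact (Nat.add_le_add_right hp2 1).trans (hinv.card_lt hr)
  refine ⟨⟨fun h => ?_, fun hr ⟨c', hstep⟩ => hstep.not_returned hr⟩, hinv.returned, ?_,
    hinv.eqs_returned, hinv.eqs_running, by omega⟩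
  · by_contra hr
    exact h (hinv.exists_step hS hr)
  · refine queries_le_of_self_bound (fun h => ?_) ?_ hpn (hk ▸ hinv.milestones_le hn ho) hp3
    · rw [hn]
      exact S.numClasses_reachable_of_card_alphabet_eq_zero (hk ▸ h)
    · rw [ho]
      exact R.numClasses_pos ⟨R.init, trivial⟩
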